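/- **Model.** Let $\mathsf A$ be a finite alphabet with $|\mathsf A|\ge 2$, let $q(y\mid a)$ $(a,y\in\mathsf A)$ be the transition law of a discrete memoryless channel (DMC), and let $\epsilon\in[0,1)$. Let $\{A_i\}_{i=1}^r$ and $\{B_j\}_{j=1}^t$ be partitions of $[1:m]$ and $[1:n]$ into nonempty row clusters of sizes $m_i=|A_i|$ and column clusters of sizes $n_j=|B_j|$; they are deterministic and unknown to the estimator of part 2. The $m\times n$ matrix $\mathbf X$ is constant on each $A_i\times B_j$, and the $rt$ values on these blocks are i.i.d. uniform on $\mathsf A$. The observation $\mathbf Y\in(\mathsf A\cup\{e\})^{m\times n}$ is obtained by passing the entries of $\mathbf X$ independently through the DMC $q$ and then through an erasure channel with erasure probability $\epsilon$ ($e$ denotes an erasure). For an estimator $\hat{\mathbf X}=\varphi(\mathbf Y)$ let $\bar P_e=\Pr(\hat{\mathbf X}\ne\mathbf X)$, where the probability is over both $\mathbf X$ and $\mathbf Y$. Put $$\mu_{ab}=\sum_{y\ne z}q(y\mid a)q(z\mid b),\qquad d_{lb}=\frac1{|\mathsf A|}\sum_{a}\mu_{aa},\qquad d_{ub}=\frac1{|\mathsf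 A|^2}\sum_{a,b}\mu_{ab}.$$ **Estimator (threshold $d_0$).** For rows $i,i'$ let $d_{ii'}$ be the number of columns $k$ with $Y_{ik}\neq e$, $Y_{i'k}\ne e$, $Y_{ik}\ne Y_{i'k}$, divided by the number of columns $k$ with $Y_{ik}\neq e$, $Y_{i'k}\ne e$ (and $0$ if there is no such column). Rows $i,i'$ are declared to be in the same cluster iff $d_{ii'}<d_0$; columns are clustered in the same way. The entry $\hat X_{ij}$ is a maximum likelihood estimate (any tie-breaking) from the non-erased observations in the block formed by the rows declared to be in the cluster of $i$ and the columns declared to be in the cluster of $j$, that is, a maximizer over $a \in\mathsf A$ of the product of $q(Y_{i'j'}\mid a)$ over these observations. **Theorem.** There exist constants $p_1,p_2\in(0,1)$, $p_1>p_2$, depending only on $\mathsf A,q,\epsilon$, such that the following hold for all sequences of sizes $(m,n)$ with $mn\to\infty$ and all sequences of row and column clusters. 1. **Converse.** Suppose that $\epsilon>0$ or that there are $a\ne b$ and $y$ in $\mathsf A$ with $q(y\mid a)>0$ and $q(y\mid b)>0$. If, for some constant $\eta>0$ and all large sizes, $$\max_{i,j}m_in_j<(1-\eta)\frac{\ln(mn)}{\ln(1/p_2)},$$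 then $\bar P_e\to1$ for any sequence of estimators. 2. **Achievability.** Suppose that for all $a\ne b$ in $\mathsf A$ there is a $y$ with $q(y\mid a)\ne q(y\mid b)$. Let $d_0\in(d_{lb},d_{ub})$. Then the estimator above, with a suitable tie-breaking, is computable in a number of steps polynomial in $m+n$ (counting real arithmetic operations, comparisons and memory accesses as one step each). Moreover there is a constant $K>0$, depending only on $\mathsf A,q,\epsilon,d_0$, such that, if for all large sizes $$\frac{n^2}{n_1^2+\dots+n_t^2}\ge K\ln m,\qquad \frac{m^2}{m_1^2+\dots+m_r^2}\ge K\ln n,\qquad \min_{i,j}m_in_j>\frac{\ln(mn)}{\ln(1/p_1)},$$ and if $\limsup m/n<\infty$ and $\limsup n/m<\infty$, then $\bar P_e\to0$ for this estimator, whatever the tie-breaking. -/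

import Mathlib

namespace CollabFilter

/-- A discrete memoryless channel with input and output alphabet `A`:
`prob a y` is the probability `q(y | a)` of the output `y` given the input `a`. -/
structure DMC (A : Type*) [Fintype A] where
  prob : A → A → ℝ
  nonneg : ∀ a y, 0 ≤ prob a y
  sum_eq_one : ∀ a, ∑ y, prob a y = 1

/-- An `m × n` matrix of observations; `none` is the erasure symbol. -/
abbrev Obs (m n : ℕ) (A : Type*) := Fin m → Fin n → Option A

/-- An `m × n` rating matrix. -/
abbrev Ratings (m n : ℕ) (A : Type*) := Fin m → Fin n → A

/-- A partition of `[1:m]` into nonempty clusters. -/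
abbrev Clustering (m : ℕ) := Finpartition (Finset.univ : Finset (Fin m))

section Model

variable {A : Type*} [Fintype A] [DecidableEq A]

/-- The cascade of the channel `W` and an erasure channel with erasure probability `ε`:
the probability of observing `o` when the true entry is `a`. -/
def obsProb (W : DMC A) (ε : ℝ) (a : A) : Option A → ℝ
  | none => ε
  | some y => (1 - ε) * W.prob a y

/-- The block constant matrix which takes the value `u R C` on the cluster `R × C`. -/
def blockMatrix {m n : ℕ} (P : Clustering m) (Q : Clustering n)
    (u : P.parts → Q.parts → A) : Ratings m n A :=
  fun i j => u ⟨P.part i, P.part_mem.2 (Finset.mem_univ i)⟩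
    ⟨Q.part j, Q.part_mem.2 (Finset.mem_univ j)⟩

/-- The probability that the block values are `u` and that the observation is `Y`: the block
values are i.i.d. uniform on `A`, and the entries pass independently through the channel. -/
noncomputable def jointProb {m n : ℕ} (W : DMC A) (ε : ℝ) (P : Clustering m) (Q : Clustering n)
    (u : P.parts → Q.parts → A) (Y : Obs m n A) : ℝ :=
  (1 / (Fintype.card A : ℝ)) ^ (P.parts.card * Q.parts.card) *
    ∏ i, ∏ j, obsProb W ε (blockMatrix P Q u i j) (Y i j)

/-- The probability that the estimate `φ Y` differs from the rating matrix in at least one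
entry, averaged over the law of the rating matrix and of the observation. -/
noncomputable def errorProb {m n : ℕ} (W : DMC A) (ε : ℝ) (P : Clustering m) (Q : Clustering n)
    (φ : Obs m n A → Ratings m n A) : ℝ :=
  ∑ u : P.parts → Q.parts → A, ∑ Y : Obs m n A,
    jointProb W ε P Q u Y * (if φ Y = blockMatrix P Q u then 0 else 1)

/-- The probability that the outputs of the channel for the inputs `a` and `b` differ. -/
noncomputable def mu (W : DMC A) (a b : A) : ℝ :=
  ∑ y, ∑ z, if y ≠ z then W.prob a y * W.prob b z else 0

/-- `d_lb`. -/
noncomputable def dLower (W : DMC A) : ℝ :=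
  (∑ a, mu W a a) / (Fintype.card A : ℝ)

/-- `d_ub`. -/
noncomputable def dUpper (W : DMC A) : ℝ :=
  (∑ a, ∑ b, mu W a b) / (Fintype.card A : ℝ) ^ 2

/-- Normalized Hamming distance of the rows `i`, `i'` over the commonly sampled columns
(`0` if there is none). -/
noncomputable def rowDist {m n : ℕ} (Y : Obs m n A) (i i' : Fin m) : ℝ :=
  ((Finset.univ.filter fun k => Y i k ≠ none ∧ Y i' k ≠ none ∧ Y i k ≠ Y i' k).card : ℝ) /
    ((Finset.univ.filter fun k => Y i k ≠ none ∧ Y i' k ≠ none).card : ℝ)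

/-- Normalized Hamming distance of the columns `j`, `j'` over the commonly sampled rows. -/
noncomputable def colDist {m n : ℕ} (Y : Obs m n A) (j j' : Fin n) : ℝ :=
  rowDist (fun l k => Y k l) j j'

/-- The estimated row cluster of `i`: the rows declared to be in the same cluster as `i`. -/
noncomputable def estRows {m n : ℕ} (d₀ : ℝ) (Y : Obs m n A) (i : Fin m) : Finset (Fin m) :=
  Finset.univ.filter fun i' => rowDist Y i i' < d₀

/-- The estimated column cluster of `j`. -/
noncomputable def estCols {m n : ℕ} (d₀ : ℝ) (Y : Obs m n A) (j : Fin n) : Finset (Fin n) :=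
  Finset.univ.filter fun j' => colDist Y j j' < d₀

/-- The likelihood of the value `a` given the non-erased observations in the block `R × C`. -/
noncomputable def blockLikelihood {m n : ℕ} (W : DMC A) (Y : Obs m n A)
    (R : Finset (Fin m)) (C : Finset (Fin n)) (a : A) : ℝ :=
  ∏ i ∈ R, ∏ j ∈ C, (Y i j).elim 1 (fun y => W.prob a y)

/-- `φ` clusters rows and columns by thresholding the normalized Hamming distances at `d₀`, and
then estimates every entry by maximum likelihood decoding in its estimated cluster. Ties in the
likelihood may be broken arbitrarily. -/
def IsThresholdML {m n : ℕ} (W : DMC A) (d₀ : ℝ) (φ : Obs m n A → Ratings m n A) : Prop :=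
  ∀ (Y : Obs m n A) (i : Fin m) (j : Fin n) (b : A),
    blockLikelihood W Y (estRows d₀ Y i) (estCols d₀ Y j) b ≤
      blockLikelihood W Y (estRows d₀ Y i) (estCols d₀ Y j) (φ Y i j)

end Model

section RunningTime

/-!  A step-counting model: real-arithmetic programs with bounded loops. The input consists of
three sizes, a table of observed symbols, a table of real channel probabilities and a real
threshold. Arithmetic operations on reals, comparisons of reals and memory accesses take one
step, as on a real random access machine. The only loops run over one of the three sizes, so
the model is a restriction of such machines. -/

/-- The contents of the read-only input memory. -/
structure Input where
  rows : ℕ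
  cols : ℕ
  letters : ℕ
  obs : ℕ → ℕ → ℕ
  chan : ℕ → ℕ → ℝ
  thr : ℝ

/-- The ranges over which a loop may run. -/
inductive Range
  | rows
  | cols
  | letters

/-- The number of iterations of a loop. -/
def Range.size (I : Input) : Range → ℕ
  | .rows => I.rows
  | .cols => I.cols
  | .letters => I.letters

/-- Programs that return a real number. Loop counters are named by natural numbers. -/
inductive Prog
  | const (c : ℕ)
  | var (v : ℕ)
  | obs (v w : ℕ)
  | chan (v w : ℕ)
  | thr
  | add (s t : Prog)
  | sub (s t : Prog)
  | mul (s t : Prog)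
  | div (s t : Prog)
  | ifLt (s t c d : Prog)
  | sum (v : ℕ) (D : Range) (body : Prog)
  | prod (v : ℕ) (D : Range) (body : Prog)

/-- The value of a program, where `ρ v` is the current value of the counter `v`. -/
noncomputable def Prog.value (I : Input) : Prog → (ℕ → ℕ) → ℝ
  | .const c, _ => c
  | .var v, ρ => ρ v
  | .obs v w, ρ => I.obs (ρ v) (ρ w)
  | .chan v w, ρ => I.chan (ρ v) (ρ w)
  | .thr, _ => I.thr
  | .add s t, ρ => s.value I ρ + t.value I ρ
  | .sub s t, ρ => s.value I ρ - t.value I ρ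
  | .mul s t, ρ => s.value I ρ * t.value I ρ
  | .div s t, ρ => s.value I ρ / t.value I ρ
  | .ifLt s t c d, ρ =>
      open Classical in if s.value I ρ < t.value I ρ then c.value I ρ else d.value I ρ
  | .sum v D body, ρ => ∑ k ∈ Finset.range (D.size I), body.value I (Function.update ρ v k)
  | .prod v D body, ρ => ∏ k ∈ Finset.range (D.size I), body.value I (Function.update ρ v k)

/-- The number of steps of a program. A loop pays in every iteration for the execution of its
body, for the update of its accumulator and for the update of its counter. -/
noncomputable def Prog.steps (I : Input) : Prog → (ℕ → ℕ) → ℕ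
  | .const _, _ => 1
  | .var _, _ => 1
  | .obs _ _, _ => 1
  | .chan _ _, _ => 1
  | .thr, _ => 1
  | .add s t, ρ => s.steps I ρ + t.steps I ρ + 1
  | .sub s t, ρ => s.steps I ρ + t.steps I ρ + 1
  | .mul s t, ρ => s.steps I ρ + t.steps I ρ + 1
  | .div s t, ρ => s.steps I ρ + t.steps I ρ + 1
  | .ifLt s t c d, ρ =>
      open Classical in
      s.steps I ρ + t.steps I ρ + 1 +
        if s.value I ρ < t.value I ρ then c.steps I ρ else d.steps I ρ
  | .sum v D body, ρ =>
      1 + ∑ k ∈ Finset.range (D.size I), (body.steps I (Function.update ρ v k) + 2)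
  | .prod v D body, ρ =>
      1 + ∑ k ∈ Finset.range (D.size I), (body.steps I (Function.update ρ v k) + 2)

/-- The counters at the start of the computation of the entry `(i, j)`. -/
def entryCounters (i j : ℕ) : ℕ → ℕ
  | 0 => i
  | 1 => j
  | _ => 0

/-- The number of steps needed to compute all the entries of the output matrix one after the
other, with two additional steps for the output of each entry. -/
noncomputable def Prog.totalSteps (I : Input) (p : Prog) : ℕ :=
  ∑ i ∈ Finset.range I.rows, ∑ j ∈ Finset.range I.cols, (p.steps I (entryCounters i j) + 2)

variable {A : Type*} [Fintype A]

/-- The input memory for given observations, channel and threshold. A letter `a` is stored as the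
number `e a`; in the table of observations `0` stands for an erasure and `e y + 1` for the
letter `y`. Cells outside of the tables hold `0`. -/
noncomputable def encodeInput (e : A ≃ Fin (Fintype.card A)) (W : DMC A) (d₀ : ℝ) {m n : ℕ}
    (Y : Obs m n A) : Input where
  rows := m
  cols := n
  letters := Fintype.card A
  obs i j := if h : i < m ∧ j < n then (Y ⟨i, h.1⟩ ⟨j, h.2⟩).elim 0 (fun y => (e y : ℕ) + 1) else 0
  chan a y :=
    if h : a < Fintype.card A ∧ y < Fintype.card A then W.prob (e.symm ⟨a, h.1⟩) (e.symm ⟨y, h.2⟩)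
    else 0
  thr := d₀

/-- One program computes the estimates `φ m n Y` for all sizes `m`, `n` and all observations `Y`,
in a number of steps that is bounded by a polynomial in `m + n`. -/
def IsPolyTime (e : A ≃ Fin (Fintype.card A)) (W : DMC A) (d₀ : ℝ)
    (φ : ∀ m n : ℕ, Obs m n A → Ratings m n A) : Prop :=
  ∃ (p : Prog) (c d : ℕ), ∀ (m n : ℕ) (Y : Obs m n A),
    (∀ (i : Fin m) (j : Fin n),
      p.value (encodeInput e W d₀ Y) (entryCounters i j) = ((e (φ m n Y i j) : ℕ) : ℝ)) ∧
    p.totalSteps (encodeInput e W d₀ Y) ≤ c * (m + n) ^ d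

end RunningTime

end CollabFilter

/-! Converse. Suppose that two letters both produce some observation `o` with probability at least
p₂; `o` is an erasure or a shared output. In a block of area s, every entry is observed as `o` with
probability at least p₂^s under either letter, so any decision on the block fails with probability
at least p₂^s / |A|, even with known clusters. The likelihood factors over blocks, so the best
decision is made block by block, and success has probability at most the product of 1 - p₂^s / |A|
(`sum_decision_le`, `sum_all_correct_le`). With N = mn and all areas below L = (1-η) ln N /
ln(1/p₂), one has p₂^s ≥ N^(η-1), and there are at least N / L blocks; the product is at most
exp(-N^η / (L |A|)), which tends to 0.

Achievability. An error requires a misclustered pair of rows or of columns, or a wrong letter at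
least as likely as the true one in a true block. For two rows, the number of disagreements minus d₀
times the number of common samples has mean n(1-ε)²(d_lb - d₀) < 0 within a cluster and n(1-ε)²(d_ub
- d₀) > 0 across clusters. It fluctuates through the channel, independently over columns, and
through the block values, independently over column clusters with weights n_j. A Hoeffding bound in
two layers (`sum_jointProb_exp_le`) gives failure probability exp(-const · n² / ∑ n_j²), small
enough for a union bound over pairs. In a true block, a given wrong letter wins with probability at
most β^s, where β < 1 is the Bhattacharyya coefficient. If β ≤ p₁², the hypothesis on the areas
makes this at most N^(-2), against at most N |A| alternatives.

Running time. Bounded loops nested to a fixed depth always cost polynomially many steps, so it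
suffices to write one program with the right value (`value_estimateProg`). -/

namespace CollabFilter

/-! ### Sums of product form and a Hoeffding bound. -/

section FiniteProducts

/-- Fubini for sums over matrices of products of entrywise factors. -/
theorem sum_matrix_prod {ι κ Ω : Type*} [Fintype ι] [DecidableEq ι] [Fintype κ] [DecidableEq κ]
    [Fintype Ω] (F : ι → κ → Ω → ℝ) :
    ∑ Y : ι → κ → Ω, ∏ i, ∏ j, F i j (Y i j) = ∏ i, ∏ j, ∑ o, F i j o := by
  simp_rw [Fintype.prod_sum]

/-- A sum over matrices whose summand factors over the columns. -/
theorem sum_matrix_prod_columns {ι κ Ω : Type*} [Fintype ι] [DecidableEq ι] [Fintype κ]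
    [DecidableEq κ] [Fintype Ω] (G : κ → (ι → Ω) → ℝ) :
    ∑ Y : ι → κ → Ω, ∏ k, G k (fun i => Y i k) = ∏ k, ∑ y, G k y := by
  rw [Fintype.prod_sum]
  exact Fintype.sum_equiv (Equiv.piComm _) _ _ fun Y => rfl

/-- The mean of a function of one coordinate under a product law. -/
theorem sum_prod_mul_single {ι Ω : Type*} [Fintype ι] [DecidableEq ι] [Fintype Ω]
    (p : ι → Ω → ℝ) (hp : ∀ i, ∑ o, p i o = 1) (i : ι) (f : Ω → ℝ) :
    ∑ y : ι → Ω, (∏ l, p l (y l)) * f (y i) = ∑ o, p i o * f o := by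
  have h : ∀ y : ι → Ω, (∏ l, p l (y l)) * f (y i) =
      ∏ l, (p l (y l) * if l = i then f (y l) else 1) := by
    intro y
    rw [Finset.prod_mul_distrib]
    simp
  simp_rw [h]
  rw [← Fintype.prod_sum fun l o => p l o * if l = i then f o else 1,
    ← Finset.mul_prod_erase _ _ (Finset.mem_univ i)]
  rw [Finset.prod_eq_one]
  · simp
  · intro l hl
    simp [Finset.ne_of_mem_erase hl, hp]

/-- The mean of a function of two coordinates under a product law. -/
theorem sum_prod_mul_pair {ι Ω : Type*} [Fintype ι] [DecidableEq ι] [Fintype Ω]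
    [DecidableEq Ω] (p : ι → Ω → ℝ) (hp : ∀ i, ∑ o, p i o = 1) {i i' : ι} (hne : i ≠ i')
    (f : Ω → Ω → ℝ) :
    ∑ y : ι → Ω, (∏ l, p l (y l)) * f (y i) (y i') =
      ∑ o, ∑ o', p i o * p i' o' * f o o' := by
  -- Fixing the value `a` of coordinate `i` by an indicator turns `f (y i) (y i')` into a product of
  -- functions of single coordinates.
  have key : ∀ a : Ω, ∑ y : ι → Ω, (∏ l, p l (y l)) * (if y i = a then f a (y i') else 0) =
      ∑ o', p i a * p i' o' * f a o' := by
    intro a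
    have hq : ∀ y : ι → Ω, (∏ l, p l (y l)) * (if y i = a then f a (y i') else 0) =
        ∏ l, (p l (y l) *
          if l = i then (if y l = a then 1 else 0) else if l = i' then f a (y l) else 1) := by
      intro y
      rw [Finset.prod_mul_distrib]
      congr 1
      rw [← Finset.mul_prod_erase _ _ (Finset.mem_univ i)]
      rw [Finset.prod_congr rfl (g := fun l => if l = i' then f a (y l) else 1)]
      · rw [Finset.prod_ite_eq' (Finset.univ.erase i) i' (fun l => f a (y l))]
        simp [hne.symm]
      · intro l hl
        simp [Finset.ne_of_mem_erase hl]
    simp_rw [hq]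
    rw [← Fintype.prod_sum fun l o => p l o *
      if l = i then (if o = a then 1 else 0) else if l = i' then f a o else 1,
      ← Finset.mul_prod_erase _ _ (Finset.mem_univ i),
      ← Finset.mul_prod_erase _ _ (Finset.mem_erase.2 ⟨hne.symm, Finset.mem_univ i'⟩)]
    rw [Finset.prod_eq_one]
    · simp [hne.symm, Finset.mul_sum, mul_assoc]
    · intro l hl
      rw [Finset.mem_erase, Finset.mem_erase] at hl
      simp [hl.1, hl.2.1, hp]
  calc _ = ∑ y : ι → Ω, ∑ a, (∏ l, p l (y l)) * (if y i = a then f a (y i') else 0) := by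
        refine Finset.sum_congr rfl fun y _ => ?_
        rw [← Finset.mul_sum]
        simp
    _ = _ := by
        rw [Finset.sum_comm]
        exact Finset.sum_congr rfl fun a _ => key a

/-- An exponential moment bound of Hoeffding type. -/
theorem sum_mul_exp_le {Ω : Type*} [Fintype Ω] (w f : Ω → ℝ) (hw : ∀ o, 0 ≤ w o)
    (hw1 : ∑ o, w o = 1) {B : ℝ} (hB : ∀ o, |f o| ≤ B) :
    ∑ o, w o * Real.exp (f o) ≤ Real.exp (∑ o, w o * f o + 2 * B ^ 2) := by
  set M := ∑ o, w o * f o with hM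
  have hMB : |M| ≤ B := by
    calc |M| ≤ ∑ o, |w o * f o| := Finset.abs_sum_le_sum_abs _ _
      _ ≤ ∑ o, w o * B := by
          refine Finset.sum_le_sum fun o _ => ?_
          rw [abs_mul, abs_of_nonneg (hw o)]
          exact mul_le_mul_of_nonneg_left (hB o) (hw o)
      _ = B := by rw [← Finset.sum_mul, hw1, one_mul]
  have hB0 : 0 ≤ B := (abs_nonneg M).trans hMB
  -- The exponential lies below its chord over [-2B, 2B], whose linear term has mean zero. The
  -- constant `2 * B ^ 2` comes from cosh(2B) ≤ exp((2B)² / 2).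
  have hpt : ∀ o, Real.exp (f o - M) ≤
      Real.cosh (2 * B) + (f o - M) * (Real.sinh (2 * B) / (2 * B)) := by
    intro o
    have hd : |f o - M| ≤ 2 * B := (abs_sub _ _).trans (by linarith [hB o])
    rcases hB0.eq_or_lt with h | h
    · have : f o - M = 0 := abs_nonpos_iff.1 (by simpa [← h] using hd)
      simp [this, ← h]
    · have ht : |(f o - M) / (2 * B)| ≤ 1 := by
        rw [abs_div, abs_of_pos (by positivity : 0 < 2 * B)]
        exact div_le_one_of_le₀ hd (by positivity)
      have := Real.exp_mul_le_cosh_add_mul_sinh ht (2 * B)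
      rw [div_mul_cancel₀ _ (by positivity)] at this
      calc _ ≤ _ := this
        _ = _ := by ring
  have hsum : ∑ o, w o * Real.exp (f o - M) ≤ Real.exp (2 * B ^ 2) := by
    calc _ ≤ ∑ o, w o * (Real.cosh (2 * B) + (f o - M) * (Real.sinh (2 * B) / (2 * B))) :=
          Finset.sum_le_sum fun o _ => mul_le_mul_of_nonneg_left (hpt o) (hw o)
      _ = (∑ o, w o) * Real.cosh (2 * B) +
          ((∑ o, w o * f o) - (∑ o, w o) * M) * (Real.sinh (2 * B) / (2 * B)) := by
          simp only [Finset.sum_mul, sub_mul, ← Finset.sum_add_distrib, ← Finset.sum_sub_distrib]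
          exact Finset.sum_congr rfl fun o _ => by ring
      _ = Real.cosh (2 * B) := by rw [hw1, ← hM]; ring
      _ ≤ _ := (Real.cosh_le_exp_half_sq _).trans (Real.exp_le_exp.2 (by nlinarith))
  calc _ = Real.exp M * ∑ o, w o * Real.exp (f o - M) := by
        rw [Finset.mul_sum]
        refine Finset.sum_congr rfl fun o _ => ?_
        rw [Real.exp_sub]
        field_simp
    _ ≤ Real.exp M * Real.exp (2 * B ^ 2) :=
        mul_le_mul_of_nonneg_left hsum (Real.exp_pos _).le
    _ = _ := by rw [Real.exp_add]

end FiniteProducts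

/-! ### Clusters and block constant matrices. -/

section Clusterings

variable {m n : ℕ}

/-- The cluster of `i`, as an element of the set of clusters. -/
def cluster (P : Clustering m) (i : Fin m) : P.parts :=
  ⟨P.part i, P.part_mem.2 (Finset.mem_univ i)⟩

theorem cluster_eq_iff (P : Clustering m) (i : Fin m) (R : P.parts) :
    cluster P i = R ↔ i ∈ (R : Finset (Fin m)) := by
  rw [← P.part_eq_iff_mem R.2, Subtype.ext_iff]
  rfl

theorem cluster_surjective (P : Clustering m) : Function.Surjective (cluster P) := by
  intro R
  obtain ⟨i, hi⟩ := P.nonempty_of_mem_parts R.2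
  exact ⟨i, (cluster_eq_iff P i R).2 hi⟩

theorem filter_cluster_eq (P : Clustering m) (R : P.parts) :
    (Finset.univ.filter fun i => cluster P i = R) = (R : Finset (Fin m)) := by
  ext i
  simp [cluster_eq_iff]

theorem sum_comp_cluster (P : Clustering m) (g : P.parts → ℝ) :
    ∑ i, g (cluster P i) = ∑ R : P.parts, ((R : Finset (Fin m)).card : ℝ) * g R := by
  rw [← Finset.sum_fiberwise Finset.univ (cluster P)]
  refine Finset.sum_congr rfl fun R _ => ?_
  rw [Finset.sum_congr rfl (g := fun _ => g R), Finset.sum_const, filter_cluster_eq,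
    nsmul_eq_mul]
  intro i hi
  rw [(Finset.mem_filter.1 hi).2]

theorem sum_card_clusters (P : Clustering m) :
    ∑ R : P.parts, ((R : Finset (Fin m)).card : ℝ) = m := by
  have := sum_comp_cluster P fun _ => 1
  simpa using this.symm

theorem card_cluster_pos (P : Clustering m) (R : P.parts) :
    (1 : ℝ) ≤ ((R : Finset (Fin m)).card : ℝ) := by
  exact_mod_cast Finset.card_pos.2 (P.nonempty_of_mem_parts R.2)

/-- Clusters are nonempty, so each size is at most its square. This absorbs the channel noise into
the fluctuation of the block values in `sum_jointProb_exp_le`. -/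
theorem card_le_sum_sq (P : Clustering m) :
    (m : ℝ) ≤ ∑ R : P.parts, ((R : Finset (Fin m)).card : ℝ) ^ 2 := by
  rw [← sum_card_clusters P]
  exact Finset.sum_le_sum fun R _ => by nlinarith [card_cluster_pos P R]

theorem card_clusters_le (P : Clustering m) : P.parts.card ≤ m := by
  simpa using P.card_parts_le_card

theorem blockMatrix_apply {A : Type*} (P : Clustering m) (Q : Clustering n)
    (u : P.parts → Q.parts → A)
    (i : Fin m) (j : Fin n) : blockMatrix P Q u i j = u (cluster P i) (cluster Q j) := rfl

theorem blockMatrix_injective {A : Type*} (P : Clustering m) (Q : Clustering n) :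
    Function.Injective (blockMatrix (A := A) P Q) := by
  intro u v h
  funext R C
  obtain ⟨i, rfl⟩ := cluster_surjective P R
  obtain ⟨j, rfl⟩ := cluster_surjective Q C
  exact congrFun (congrFun h i) j

end Clusterings

/-! ### The joint law and union bounds. -/

section Probability

variable {A : Type*} [Fintype A] {m n : ℕ}

theorem obsProb_nonneg (W : DMC A) {ε : ℝ} (h0 : 0 ≤ ε) (h1 : ε < 1) (a : A) (o : Option A) :
    0 ≤ obsProb W ε a o := by
  cases o with
  | none => exact h0
  | some y => exact mul_nonneg (by linarith) (W.nonneg a y)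

theorem sum_obsProb (W : DMC A) (ε : ℝ) (a : A) : ∑ o, obsProb W ε a o = 1 := by
  rw [Fintype.sum_option]
  simp only [obsProb]
  rw [← Finset.mul_sum, W.sum_eq_one]
  ring

theorem jointProb_nonneg (W : DMC A) {ε : ℝ} (h0 : 0 ≤ ε) (h1 : ε < 1) (P : Clustering m)
    (Q : Clustering n) (u : P.parts → Q.parts → A) (Y : Obs m n A) :
    0 ≤ jointProb W ε P Q u Y :=
  mul_nonneg (by positivity)
    (Finset.prod_nonneg fun _ _ => Finset.prod_nonneg fun _ _ => obsProb_nonneg W h0 h1 _ _)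

theorem sum_prior [DecidableEq A] (hA : 2 ≤ Fintype.card A) (P : Clustering m)
    (Q : Clustering n) :
    ∑ _u : P.parts → Q.parts → A, (1 / (Fintype.card A : ℝ)) ^ (P.parts.card * Q.parts.card) =
      1 := by
  have : (Fintype.card A : ℝ) ≠ 0 := by positivity
  simp only [Finset.sum_const, Finset.card_univ, Fintype.card_fun, Fintype.card_coe, nsmul_eq_mul,
    Nat.cast_pow, ← pow_mul]
  rw [mul_comm Q.parts.card, ← mul_pow, mul_one_div_cancel this, one_pow]

theorem sum_jointProb [DecidableEq A] (hA : 2 ≤ Fintype.card A) (W : DMC A) (ε : ℝ)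
    (P : Clustering m) (Q : Clustering n) :
    ∑ u : P.parts → Q.parts → A, ∑ Y : Obs m n A, jointProb W ε P Q u Y = 1 := by
  rw [← sum_prior hA P Q]
  refine Finset.sum_congr rfl fun u _ => ?_
  simp only [jointProb]
  rw [← Finset.mul_sum, sum_matrix_prod fun i j o => obsProb W ε (blockMatrix P Q u i j) o]
  simp only [sum_obsProb, Finset.prod_const_one, mul_one]

open Classical in
/-- The probability of an event. -/
noncomputable def eventProb (W : DMC A) (ε : ℝ) (P : Clustering m) (Q : Clustering n)
    (E : (P.parts → Q.parts → A) → Obs m n A → Prop) : ℝ :=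
  ∑ u : P.parts → Q.parts → A, ∑ Y : Obs m n A,
    jointProb W ε P Q u Y * (if E u Y then 1 else 0)

/-- A bound in the manner of Markov. -/
theorem eventProb_le_sum (W : DMC A) {ε : ℝ} (h0 : 0 ≤ ε) (h1 : ε < 1) (P : Clustering m)
    (Q : Clustering n) (E : (P.parts → Q.parts → A) → Obs m n A → Prop)
    (F : (P.parts → Q.parts → A) → Obs m n A → ℝ) (hF : ∀ u Y, 0 ≤ F u Y)
    (hEF : ∀ u Y, E u Y → 1 ≤ F u Y) :
    eventProb W ε P Q E ≤ ∑ u, ∑ Y, jointProb W ε P Q u Y * F u Y := by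
  refine Finset.sum_le_sum fun u _ => Finset.sum_le_sum fun Y _ =>
    mul_le_mul_of_nonneg_left ?_ (jointProb_nonneg W h0 h1 _ _ _ _)
  split_ifs with h
  · exact hEF u Y h
  · exact hF u Y

/-- The union bound. -/
theorem eventProb_le_sum_eventProb (W : DMC A) {ε : ℝ} (h0 : 0 ≤ ε) (h1 : ε < 1)
    (P : Clustering m) (Q : Clustering n) {ι : Type*} (s : Finset ι)
    (E : (P.parts → Q.parts → A) → Obs m n A → Prop)
    (E' : ι → (P.parts → Q.parts → A) → Obs m n A → Prop)
    (h : ∀ u Y, E u Y → ∃ x ∈ s, E' x u Y) :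
    eventProb W ε P Q E ≤ ∑ x ∈ s, eventProb W ε P Q (E' x) := by
  classical
  calc _ ≤ ∑ u, ∑ Y, jointProb W ε P Q u Y * ∑ x ∈ s, (if E' x u Y then (1 : ℝ) else 0) := by
        have hnn : ∀ u Y, ∀ x ∈ s, (0 : ℝ) ≤ if E' x u Y then (1 : ℝ) else 0 :=
          fun u Y x _ => by split_ifs <;> norm_num
        refine eventProb_le_sum W h0 h1 P Q E _ (fun u Y => Finset.sum_nonneg (hnn u Y)) ?_
        intro u Y hE
        obtain ⟨x, hx, hE'⟩ := h u Y hE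
        exact le_trans (by simp [hE']) (Finset.single_le_sum (hnn u Y) hx)
    _ = _ := by
        simp only [eventProb, Finset.mul_sum]
        rw [Finset.sum_comm (s := s)]
        exact Finset.sum_congr rfl fun u _ => Finset.sum_comm

end Probability

/-! ### Concentration of the row distances. -/

section RowClustering

variable {A : Type*} [Fintype A] [DecidableEq A] {m n : ℕ}

theorem mu_nonneg (W : DMC A) (a b : A) : 0 ≤ mu W a b :=
  Finset.sum_nonneg fun y _ => Finset.sum_nonneg fun z _ => by
    split_ifs
    · exact mul_nonneg (W.nonneg a y) (W.nonneg b z)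
    · exact le_rfl

theorem mu_le_one (W : DMC A) (a b : A) : mu W a b ≤ 1 := by
  calc mu W a b ≤ ∑ y, ∑ z, W.prob a y * W.prob b z :=
        Finset.sum_le_sum fun y _ => Finset.sum_le_sum fun z _ => by
          split_ifs
          · exact le_rfl
          · exact mul_nonneg (W.nonneg a y) (W.nonneg b z)
    _ = 1 := by simp_rw [← Finset.mul_sum, W.sum_eq_one, mul_one, W.sum_eq_one]

theorem dLower_nonneg (W : DMC A) : 0 ≤ dLower W :=
  div_nonneg (Finset.sum_nonneg fun a _ => mu_nonneg W a a) (by positivity)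

theorem dUpper_le_one (hA : 2 ≤ Fintype.card A) (W : DMC A) : dUpper W ≤ 1 := by
  have : (0 : ℝ) < (Fintype.card A : ℝ) := by positivity
  rw [dUpper, div_le_one (by positivity)]
  calc _ ≤ ∑ _a : A, ∑ _b : A, (1 : ℝ) :=
        Finset.sum_le_sum fun a _ => Finset.sum_le_sum fun b _ => mu_le_one W a b
    _ = _ := by simp [sq]

/-- The contribution of a pair of observations to the unnormalized distance, centered at the
threshold. -/
noncomputable def pairScore (d₀ : ℝ) (o o' : Option A) : ℝ :=
  if o ≠ none ∧ o' ≠ none then (if o ≠ o' then 1 else 0) - d₀ else 0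

omit [Fintype A] in
theorem abs_pairScore_le {d₀ : ℝ} (h0 : 0 ≤ d₀) (h1 : d₀ ≤ 1) (o o' : Option A) :
    |pairScore d₀ o o'| ≤ 1 := by
  unfold pairScore
  split_ifs <;> rw [abs_le] <;> constructor <;> linarith

omit [Fintype A] in
theorem sum_pairScore (d₀ : ℝ) (Y : Obs m n A) (i i' : Fin m) :
    ∑ k, pairScore d₀ (Y i k) (Y i' k) =
      ((Finset.univ.filter fun k => Y i k ≠ none ∧ Y i' k ≠ none ∧ Y i k ≠ Y i' k).card : ℝ) -
        d₀ * ((Finset.univ.filter fun k => Y i k ≠ none ∧ Y i' k ≠ none).card : ℝ) := by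
  rw [Finset.card_filter, Finset.card_filter]
  push_cast
  rw [Finset.mul_sum, ← Finset.sum_sub_distrib]
  refine Finset.sum_congr rfl fun k _ => ?_
  unfold pairScore
  by_cases h1 : Y i k = none <;> by_cases h2 : Y i' k = none <;> simp [h1, h2]

omit [Fintype A] in
theorem sum_pairScore_nonneg {d₀ : ℝ} (h0 : 0 < d₀) {Y : Obs m n A} {i i' : Fin m}
    (h : ¬ rowDist Y i i' < d₀) : 0 ≤ ∑ k, pairScore d₀ (Y i k) (Y i' k) := by
  rw [sum_pairScore, sub_nonneg]
  rw [not_lt, rowDist] at h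
  rcases Nat.eq_zero_or_pos (Finset.univ.filter fun k => Y i k ≠ none ∧ Y i' k ≠ none).card
    with h' | h'
  -- Without a common column the distance is 0, below the positive threshold, so this case cannot
  -- occur.
  · rw [h', Nat.cast_zero, div_zero] at h
    linarith
  · exact (le_div_iff₀ (by exact_mod_cast h')).1 h

omit [Fintype A] in
theorem sum_pairScore_nonpos {d₀ : ℝ} {Y : Obs m n A} {i i' : Fin m}
    (h : rowDist Y i i' < d₀) : ∑ k, pairScore d₀ (Y i k) (Y i' k) ≤ 0 := by
  rw [sum_pairScore, sub_nonpos]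
  rw [rowDist] at h
  rcases Nat.eq_zero_or_pos (Finset.univ.filter fun k => Y i k ≠ none ∧ Y i' k ≠ none).card
    with h' | h'
  · have : (Finset.univ.filter fun k => Y i k ≠ none ∧ Y i' k ≠ none ∧ Y i k ≠ Y i' k).card ≤
        (Finset.univ.filter fun k => Y i k ≠ none ∧ Y i' k ≠ none).card := by
      refine Finset.card_le_card fun k hk => ?_
      simp only [Finset.mem_filter] at hk ⊢
      exact ⟨hk.1, hk.2.1, hk.2.2.1⟩
    rw [h'] at this ⊢
    simp [Nat.le_zero.1 this]
  · exact ((div_lt_iff₀ (by exact_mod_cast h')).1 h).le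

/-- The score vanishes unless both entries survive erasure, which has probability (1-ε)². Centering
at the threshold avoids the division by a random number of common columns. -/
theorem mean_pairScore (W : DMC A) (ε d₀ : ℝ) (a b : A) :
    ∑ o, ∑ o', obsProb W ε a o * obsProb W ε b o' * pairScore d₀ o o' =
      (1 - ε) ^ 2 * (mu W a b - d₀) := by
  have h1 : ∑ y, ∑ z, W.prob a y * W.prob b z = 1 := by
    simp_rw [← Finset.mul_sum, W.sum_eq_one, mul_one, W.sum_eq_one]
  have h2 : mu W a b - d₀ =
      ∑ y, ∑ z, W.prob a y * W.prob b z * ((if y ≠ z then 1 else 0) - d₀) := by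
    simp_rw [mul_sub, Finset.sum_sub_distrib, ← Finset.sum_mul, h1, one_mul, mu]
    simp
  rw [h2, Fintype.sum_option]
  simp only [Fintype.sum_option, Finset.mul_sum]
  simp only [pairScore, obsProb, ne_eq, not_true_eq_false, reduceCtorEq, not_false_eq_true,
    and_true, and_false, if_true, if_false, mul_zero, Finset.sum_const_zero,
    add_zero, zero_add, and_self, Option.some_inj]
  refine Finset.sum_congr rfl fun y _ => Finset.sum_congr rfl fun z _ => ?_
  ring

/-- Exponential moment of the centered distance of two rows given the block values. -/
theorem sum_obs_exp_pairScore_le (W : DMC A) {ε : ℝ} (hε0 : 0 ≤ ε) (hε1 : ε < 1) {d₀ : ℝ}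
    (h0 : 0 ≤ d₀) (h1 : d₀ ≤ 1) (X : Ratings m n A) {i i' : Fin m} (hne : i ≠ i') (l : ℝ) :
    ∑ Y : Obs m n A, (∏ r, ∏ k, obsProb W ε (X r k) (Y r k)) *
        Real.exp (l * ∑ k, pairScore d₀ (Y i k) (Y i' k)) ≤
      Real.exp (∑ k, (l * ((1 - ε) ^ 2 * (mu W (X i k) (X i' k) - d₀)) + 2 * l ^ 2)) := by
  -- Given the rating matrix, the columns are independent.
  have hcol : ∀ Y : Obs m n A, (∏ r, ∏ k, obsProb W ε (X r k) (Y r k)) *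
      Real.exp (l * ∑ k, pairScore d₀ (Y i k) (Y i' k)) =
      ∏ k, ((∏ r, obsProb W ε (X r k) (Y r k)) *
        Real.exp (l * pairScore d₀ (Y i k) (Y i' k))) := by
    intro Y
    rw [Finset.prod_mul_distrib, Finset.prod_comm, Finset.mul_sum, Real.exp_sum]
  simp_rw [hcol]
  rw [sum_matrix_prod_columns fun k y => (∏ r, obsProb W ε (X r k) (y r)) *
    Real.exp (l * pairScore d₀ (y i) (y i')), Real.exp_sum]
  refine Finset.prod_le_prod (fun k _ => Finset.sum_nonneg fun y _ => mul_nonneg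
    (Finset.prod_nonneg fun r _ => obsProb_nonneg W hε0 hε1 _ _) (Real.exp_pos _).le)
    fun k _ => ?_
  refine (sum_mul_exp_le (fun y : Fin m → Option A => ∏ r, obsProb W ε (X r k) (y r))
    (fun y => l * pairScore d₀ (y i) (y i'))
    (fun y => Finset.prod_nonneg fun r _ => obsProb_nonneg W hε0 hε1 _ _) ?_ (B := |l|) ?_).trans
    (le_of_eq ?_)
  · rw [← Fintype.prod_sum fun r o => obsProb W ε (X r k) o]
    simp only [sum_obsProb, Finset.prod_const_one]
  · intro y
    rw [abs_mul]
    exact mul_le_of_le_one_right (abs_nonneg _) (abs_pairScore_le h0 h1 _ _)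
  · rw [sum_prod_mul_pair (fun r o => obsProb W ε (X r k) o) (fun r => sum_obsProb W ε _) hne
      fun o o' => l * pairScore d₀ o o', ← mean_pairScore, Finset.mul_sum, sq_abs]
    simp_rw [Finset.mul_sum]
    congr 2
    exact Finset.sum_congr rfl fun o _ => Finset.sum_congr rfl fun o' _ => by ring

/-- The mean of `mu` over the values of two row clusters. -/
noncomputable def meanMu (W : DMC A) (P : Clustering m) (R R' : P.parts) : ℝ :=
  ∑ v : P.parts → A, (∏ _S : P.parts, (1 / (Fintype.card A : ℝ))) * mu W (v R) (v R')

omit [DecidableEq A] in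
theorem sum_uniform (hA : 2 ≤ Fintype.card A) : ∑ _a : A, (1 / (Fintype.card A : ℝ)) = 1 := by
  have : (Fintype.card A : ℝ) ≠ 0 := by positivity
  simp [this]

/-- Rows of one cluster share their letter, whereas in `meanMu_of_ne` the two letters are
independent; the two means lie on opposite sides of the threshold. -/
theorem meanMu_self (hA : 2 ≤ Fintype.card A) (W : DMC A) (P : Clustering m) (R : P.parts) :
    meanMu W P R R = dLower W := by
  rw [meanMu, sum_prod_mul_single (fun _ _ => 1 / (Fintype.card A : ℝ))
    (fun _ => sum_uniform hA) R fun a => mu W a a, dLower, ← Finset.mul_sum]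
  ring

theorem meanMu_of_ne (hA : 2 ≤ Fintype.card A) (W : DMC A) (P : Clustering m) {R R' : P.parts}
    (h : R ≠ R') : meanMu W P R R' = dUpper W := by
  rw [meanMu, sum_prod_mul_pair (fun _ _ => 1 / (Fintype.card A : ℝ))
    (fun _ => sum_uniform hA) h fun a b => mu W a b, dUpper]
  simp_rw [← Finset.mul_sum]
  ring

/-- Exponential moment of the centered distance of two rows. -/
theorem sum_jointProb_exp_le (hA : 2 ≤ Fintype.card A) (W : DMC A) {ε : ℝ} (hε0 : 0 ≤ ε)
    (hε1 : ε < 1) {d₀ : ℝ} (h0 : 0 ≤ d₀) (h1 : d₀ ≤ 1) (P : Clustering m) (Q : Clustering n)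
    {i i' : Fin m} (hne : i ≠ i') (l : ℝ) :
    ∑ u, ∑ Y : Obs m n A, jointProb W ε P Q u Y *
        Real.exp (l * ∑ k, pairScore d₀ (Y i k) (Y i' k)) ≤
      Real.exp (l * (n * ((1 - ε) ^ 2 * (meanMu W P (cluster P i) (cluster P i') - d₀))) +
        4 * l ^ 2 * ∑ C : Q.parts, ((C : Finset (Fin n)).card : ℝ) ^ 2) := by
  set R := cluster P i
  set R' := cluster P i'
  set g : A → A → ℝ := fun a b => (1 - ε) ^ 2 * (mu W a b - d₀) with hg
  have hg1 : ∀ a b, |g a b| ≤ 1 := by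
    intro a b
    rw [hg, abs_mul]
    refine mul_le_one₀ ?_ (abs_nonneg _) ?_
    · rw [abs_of_nonneg (sq_nonneg _)]
      exact pow_le_one₀ (by linarith) (by linarith)
    · rw [abs_le]
      constructor <;> linarith [mu_nonneg W a b, mu_le_one W a b]
  set c : ℝ := 1 / (Fintype.card A : ℝ) with hc
  have hc0 : 0 ≤ c := by positivity
  -- First layer: averaging over the channel with the block values fixed costs `2 * l ^ 2` per
  -- column.
  have step1 : ∀ u : P.parts → Q.parts → A, ∑ Y : Obs m n A, jointProb W ε P Q u Y *
        Real.exp (l * ∑ k, pairScore d₀ (Y i k) (Y i' k)) ≤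
      Real.exp (2 * l ^ 2 * n) * ∏ C : Q.parts, ((∏ _S : P.parts, c) *
        Real.exp (((C : Finset (Fin n)).card : ℝ) * (l * g (u R C) (u R' C)))) := by
    intro u
    have hb := sum_obs_exp_pairScore_le W hε0 hε1 h0 h1 (blockMatrix P Q u) hne l
    calc _ = c ^ (P.parts.card * Q.parts.card) * ∑ Y : Obs m n A,
          (∏ r, ∏ k, obsProb W ε (blockMatrix P Q u r k) (Y r k)) *
          Real.exp (l * ∑ k, pairScore d₀ (Y i k) (Y i' k)) := by
          rw [Finset.mul_sum]
          exact Finset.sum_congr rfl fun Y _ => mul_assoc _ _ _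
      _ ≤ c ^ (P.parts.card * Q.parts.card) * _ :=
          mul_le_mul_of_nonneg_left hb (by positivity)
      _ = _ := by
          simp only [blockMatrix_apply]
          rw [Finset.sum_add_distrib, sum_comp_cluster Q fun C =>
            l * ((1 - ε) ^ 2 * (mu W (u R C) (u R' C) - d₀)), Finset.prod_mul_distrib,
            ← Real.exp_sum, Real.exp_add]
          simp only [Finset.prod_const, Finset.card_univ, Fintype.card_coe, Finset.sum_const,
            Fintype.card_fin, nsmul_eq_mul, ← pow_mul, hg]
          rw [mul_comm (n : ℝ)]
          ring
  calc _ ≤ ∑ u : P.parts → Q.parts → A, _ := Finset.sum_le_sum fun u _ => step1 u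
    _ = Real.exp (2 * l ^ 2 * n) * ∏ C : Q.parts, ∑ v : P.parts → A, (∏ _S : P.parts, c) *
        Real.exp (((C : Finset (Fin n)).card : ℝ) * (l * g (v R) (v R'))) := by
        rw [← Finset.mul_sum, sum_matrix_prod_columns fun (C : Q.parts) (v : P.parts → A) =>
          (∏ _S : P.parts, c) *
          Real.exp (((C : Finset (Fin n)).card : ℝ) * (l * g (v R) (v R')))]
    -- Second layer: values in different column clusters are independent, and a cluster of size n_j
    -- moves the exponent by at most n_j |l|; hence the sum of squares.
    _ ≤ Real.exp (2 * l ^ 2 * n) * ∏ C : Q.parts,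
        Real.exp (((C : Finset (Fin n)).card : ℝ) * (l * ((1 - ε) ^ 2 * (meanMu W P R R' - d₀)))
          + 2 * (((C : Finset (Fin n)).card : ℝ) * |l|) ^ 2) := by
        refine mul_le_mul_of_nonneg_left (Finset.prod_le_prod (fun C _ => Finset.sum_nonneg
          fun v _ => by positivity) fun C _ => ?_) (Real.exp_pos _).le
        have hw1 : ∑ _v : P.parts → A, (∏ _S : P.parts, c) = 1 := by
          rw [← Fintype.prod_sum fun (_ : P.parts) (_ : A) => c]
          simp only [sum_uniform hA, hc, Finset.prod_const_one]
        refine (sum_mul_exp_le (fun _ : P.parts → A => ∏ _S : P.parts, c) _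
          (fun _ => by positivity) hw1
          (B := ((C : Finset (Fin n)).card : ℝ) * |l|) ?_).trans (le_of_eq ?_)
        · intro v
          rw [abs_mul, abs_mul, abs_of_nonneg (Nat.cast_nonneg _)]
          exact mul_le_mul_of_nonneg_left (mul_le_of_le_one_right (abs_nonneg _) (hg1 _ _))
            (Nat.cast_nonneg _)
        · congr 2
          have : meanMu W P R R' - d₀ =
              ∑ v : P.parts → A, (∏ _S : P.parts, c) * (mu W (v R) (v R') - d₀) := by
            simp_rw [mul_sub, Finset.sum_sub_distrib, ← Finset.sum_mul, hw1, one_mul]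
            rfl
          rw [this]
          simp_rw [hg, Finset.mul_sum]
          exact Finset.sum_congr rfl fun v _ => by ring
    _ ≤ _ := by
        rw [← Real.exp_sum, ← Real.exp_add, Real.exp_le_exp, Finset.sum_add_distrib,
          ← Finset.sum_mul, sum_card_clusters]
        simp_rw [mul_pow, sq_abs]
        rw [← Finset.mul_sum, ← Finset.sum_mul]
        nlinarith [card_le_sum_sq Q, sq_nonneg l, mul_le_mul_of_nonneg_left (card_le_sum_sq Q)
          (sq_nonneg l)]

/-- The event that the rows are not clustered correctly. -/
def RowError (P : Clustering m) (d₀ : ℝ) (Y : Obs m n A) : Prop :=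
  ∃ i i', ¬ (rowDist Y i i' < d₀ ↔ P.part i = P.part i')

omit [Fintype A] in
theorem rowDist_self (Y : Obs m n A) (i : Fin m) : rowDist Y i i = 0 := by
  simp [rowDist]

/-- The value of the Chernoff exponent at the chosen parameter. -/
theorem chernoff_exponent (c n S : ℝ) :
    -(c * n / (8 * S)) * (n * c) + 4 * (c * n / (8 * S)) ^ 2 * S = -(c ^ 2 / 16 * (n ^ 2 / S)) := by
  rcases eq_or_ne S 0 with h | h
  · simp [h]
  · field_simp
    ring

/-- The probability that a pair of rows is misclassified. -/
theorem eventProb_pair_le (hA : 2 ≤ Fintype.card A) (W : DMC A) {ε : ℝ} (hε0 : 0 ≤ ε)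
    (hε1 : ε < 1) {d₀ : ℝ} (h0 : dLower W < d₀) (h1 : d₀ < dUpper W) (P : Clustering m)
    (Q : Clustering n) (i i' : Fin m) {c : ℝ} (hc : 0 ≤ c)
    (hcl : c ≤ (1 - ε) ^ 2 * (d₀ - dLower W)) (hcu : c ≤ (1 - ε) ^ 2 * (dUpper W - d₀)) :
    eventProb W ε P Q (fun _ Y => ¬ (rowDist Y i i' < d₀ ↔ P.part i = P.part i')) ≤
      Real.exp (-(c ^ 2 / 16 * ((n : ℝ) ^ 2 /
        ∑ C : Q.parts, ((C : Finset (Fin n)).card : ℝ) ^ 2))) := by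
  have hd0 : 0 < d₀ := (dLower_nonneg W).trans_lt h0
  have hd1 : d₀ ≤ 1 := h1.le.trans (dUpper_le_one hA W)
  by_cases hne : i = i'
  · subst hne
    simp only [rowDist_self, hd0, not_true_eq_false, eventProb, if_false, mul_zero,
      Finset.sum_const_zero]
    exact (Real.exp_pos _).le
  obtain ⟨S, hS⟩ : ∃ S : ℝ, S = ∑ C : Q.parts, ((C : Finset (Fin n)).card : ℝ) ^ 2 := ⟨_, rfl⟩
  have hS0 : 0 ≤ S := (Nat.cast_nonneg n).trans (hS ▸ card_le_sum_sq Q)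
  rw [← hS]
  have main : ∀ l : ℝ, (∀ Y : Obs m n A, ¬ (rowDist Y i i' < d₀ ↔ P.part i = P.part i') →
      0 ≤ l * ∑ k, pairScore d₀ (Y i k) (Y i' k)) →
      eventProb W ε P Q (fun _ Y => ¬ (rowDist Y i i' < d₀ ↔ P.part i = P.part i')) ≤
      Real.exp (l * (n * ((1 - ε) ^ 2 * (meanMu W P (cluster P i) (cluster P i') - d₀))) +
        4 * l ^ 2 * S) := by
    intro l hl
    exact (eventProb_le_sum W hε0 hε1 P Q _ _ (fun _ Y => (Real.exp_pos _).le)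
      fun u Y hY => Real.one_le_exp (hl Y hY)).trans
      (hS ▸ sum_jointProb_exp_le hA W hε0 hε1 hd0.le hd1 P Q hne l)
  -- This parameter minimizes `-l * (n * c) + 4 * l ^ 2 * S`. It is used with a plus sign against
  -- separating rows of one cluster and with a minus sign against merging two clusters.
  have hlam : 0 ≤ c * n / (8 * S) := by positivity
  have hnum := chernoff_exponent c n S
  have hcn : 0 ≤ c * n / (8 * S) * n := by positivity
  by_cases hP : P.part i = P.part i'
  · have hR : cluster P i = cluster P i' := Subtype.ext hP
    refine (main (c * n / (8 * S)) fun Y hY => mul_nonneg hlam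
      (sum_pairScore_nonneg hd0 fun h => hY (by simp [h, hP]))).trans ?_
    rw [Real.exp_le_exp, ← hnum, hR, meanMu_self hA]
    nlinarith [mul_le_mul_of_nonneg_left hcl hcn]
  · have hR : cluster P i ≠ cluster P i' := fun h => hP (congrArg Subtype.val h)
    refine (main (-(c * n / (8 * S))) fun Y hY => ?_).trans ?_
    · have : rowDist Y i i' < d₀ := by
        by_contra h
        exact hY (by simp [h, hP])
      have := sum_pairScore_nonpos this
      nlinarith
    rw [Real.exp_le_exp, ← hnum, meanMu_of_ne hA W P hR]
    nlinarith [mul_le_mul_of_nonneg_left hcu hcn]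

/-- Union bound over the m² pairs: `48 = 3 * 16` makes each pair fail with probability at most m⁻³.
-/
theorem eventProb_rowError_le (hA : 2 ≤ Fintype.card A) (W : DMC A) {ε : ℝ} (hε0 : 0 ≤ ε)
    (hε1 : ε < 1) {d₀ : ℝ} (h0 : dLower W < d₀) (h1 : d₀ < dUpper W) (P : Clustering m)
    (Q : Clustering n) {c : ℝ} (hc : 0 < c)
    (hcl : c ≤ (1 - ε) ^ 2 * (d₀ - dLower W)) (hcu : c ≤ (1 - ε) ^ 2 * (dUpper W - d₀))
    (hK : 48 / c ^ 2 * Real.log m ≤ (n : ℝ) ^ 2 / ∑ C ∈ Q.parts, (C.card : ℝ) ^ 2) :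
    eventProb W ε P Q (fun _ Y => RowError P d₀ Y) ≤ 1 / (m : ℝ) := by
  rcases Nat.eq_zero_or_pos m with hm | hm
  · subst hm
    simp [eventProb, RowError]
  have hm' : (0 : ℝ) < m := by exact_mod_cast hm
  rw [← Finset.sum_coe_sort] at hK
  have hexp : Real.exp (-(c ^ 2 / 16 * ((n : ℝ) ^ 2 /
      ∑ C : Q.parts, ((C : Finset (Fin n)).card : ℝ) ^ 2))) ≤ 1 / (m : ℝ) ^ 3 := by
    have : 1 / (m : ℝ) ^ 3 = Real.exp (-(3 * Real.log m)) := by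
      rw [Real.exp_neg, mul_comm, Real.exp_mul, Real.exp_log hm', one_div]
      norm_cast
    rw [this, Real.exp_le_exp, neg_le_neg_iff]
    calc 3 * Real.log m = c ^ 2 / 16 * (48 / c ^ 2 * Real.log m) := by field_simp; ring
      _ ≤ _ := mul_le_mul_of_nonneg_left hK (by positivity)
  calc _ ≤ ∑ x : Fin m × Fin m, eventProb W ε P Q
        (fun _ Y => ¬ (rowDist Y x.1 x.2 < d₀ ↔ P.part x.1 = P.part x.2)) :=
        eventProb_le_sum_eventProb W hε0 hε1 P Q _ _ _
          fun u Y ⟨i, i', h⟩ => ⟨(i, i'), Finset.mem_univ _, h⟩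
    _ ≤ ∑ _x : Fin m × Fin m, 1 / (m : ℝ) ^ 3 := Finset.sum_le_sum fun x _ =>
        (eventProb_pair_le hA W hε0 hε1 h0 h1 P Q x.1 x.2 hc.le hcl hcu).trans hexp
    _ = 1 / (m : ℝ) := by
        simp
        field_simp

omit [DecidableEq A] in
/-- Transposition exchanges the roles of rows and columns. -/
theorem eventProb_transpose (W : DMC A) (ε : ℝ) (P : Clustering m) (Q : Clustering n)
    (E : Obs n m A → Prop) :
    eventProb W ε P Q (fun _ Y => E fun l k => Y k l) = eventProb W ε Q P (fun _ Y => E Y) := by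
  classical
  unfold eventProb
  refine Fintype.sum_equiv (Equiv.piComm _) _ _ fun u =>
    Fintype.sum_equiv (Equiv.piComm _) _ _ fun Y => ?_
  congr 1
  · unfold jointProb
    rw [Finset.prod_comm, mul_comm P.parts.card]
    rfl

end RowClustering

/-! ### Maximum likelihood decoding in the true blocks. -/

section MaximumLikelihood

variable {A : Type*} [Fintype A]

/-- The Bhattacharyya coefficient of the cascade of the channel and the erasure channel. -/
noncomputable def bhattacharyya (W : DMC A) (ε : ℝ) (a b : A) : ℝ :=
  ε + (1 - ε) * ∑ y, √(W.prob a y * W.prob b y)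

theorem bhattacharyya_nonneg (W : DMC A) {ε : ℝ} (h0 : 0 ≤ ε) (h1 : ε < 1) (a b : A) :
    0 ≤ bhattacharyya W ε a b :=
  add_nonneg h0 (mul_nonneg (by linarith) (Finset.sum_nonneg fun _ _ => Real.sqrt_nonneg _))

/-- The inequality of arithmetic and geometric means, strict at an output where the two laws differ;
ε < 1 gives that output positive weight. -/
theorem bhattacharyya_lt_one (W : DMC A) {ε : ℝ} (h1 : ε < 1) {a b : A}
    (h : ∃ y, W.prob a y ≠ W.prob b y) : bhattacharyya W ε a b < 1 := by
  obtain ⟨y₀, hy₀⟩ := h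
  have hle : ∀ y, √(W.prob a y * W.prob b y) ≤ (W.prob a y + W.prob b y) / 2 := by
    intro y
    rw [Real.sqrt_le_iff]
    constructor
    · linarith [W.nonneg a y, W.nonneg b y]
    · nlinarith [sq_nonneg (W.prob a y - W.prob b y)]
  have hlt : √(W.prob a y₀ * W.prob b y₀) < (W.prob a y₀ + W.prob b y₀) / 2 := by
    rcases (hle y₀).lt_or_eq with h | h
    · exact h
    · exfalso
      have h2 : W.prob a y₀ * W.prob b y₀ = ((W.prob a y₀ + W.prob b y₀) / 2) ^ 2 := by
        rw [← h, Real.sq_sqrt (mul_nonneg (W.nonneg _ _) (W.nonneg _ _))]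
      have h3 : (W.prob a y₀ - W.prob b y₀) ^ 2 = 0 := by linarith
      exact hy₀ (sub_eq_zero.1 (pow_eq_zero_iff two_ne_zero |>.1 h3))
  have hsum : ∑ y, √(W.prob a y * W.prob b y) < 1 := by
    calc _ < ∑ y, (W.prob a y + W.prob b y) / 2 :=
          Finset.sum_lt_sum (fun y _ => hle y) ⟨y₀, Finset.mem_univ _, hlt⟩
      _ = 1 := by
          rw [← Finset.sum_div, Finset.sum_add_distrib, W.sum_eq_one, W.sum_eq_one]
          norm_num
  unfold bhattacharyya
  nlinarith

/-- The square root of the likelihood ratio of `b` to `a` for one observation. -/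
noncomputable def sqrtRatio (W : DMC A) (a b : A) (o : Option A) : ℝ :=
  √(o.elim 1 (fun y => W.prob b y) / o.elim 1 (fun y => W.prob a y))

theorem sum_obsProb_mul_sqrtRatio (W : DMC A) (ε : ℝ) (a b : A) :
    ∑ o, obsProb W ε a o * sqrtRatio W a b o = bhattacharyya W ε a b := by
  rw [Fintype.sum_option]
  simp only [obsProb, sqrtRatio, Option.elim, div_one, Real.sqrt_one, mul_one, bhattacharyya,
    Finset.mul_sum]
  congr 1
  refine Finset.sum_congr rfl fun y _ => ?_
  rw [mul_assoc]
  congr 1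
  -- For an output impossible under `a` both sides vanish, so the division by zero is harmless.
  rcases (W.nonneg a y).eq_or_lt with h | h
  · simp [← h]
  · rw [mul_comm (W.prob a y) (W.prob b y), Real.sqrt_div' _ h.le,
      Real.sqrt_mul (W.nonneg b y)]
    have := Real.mul_self_sqrt h.le
    have h' := (Real.sqrt_pos.2 h).ne'
    field_simp
    rw [sq, this]
    ring

variable {m n : ℕ}

open Classical in
/-- The probability that a wrong value `b` of a block is at least as likely as the true value. -/
theorem sum_obs_likelihood_le [DecidableEq A] (W : DMC A) {ε : ℝ} (hε0 : 0 ≤ ε) (hε1 : ε < 1)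
    (X : Ratings m n A) (R : Finset (Fin m)) (C : Finset (Fin n)) (a b : A)
    (hX : ∀ i ∈ R, ∀ j ∈ C, X i j = a) (E : Obs m n A → Prop)
    (hE : ∀ Y, E Y → blockLikelihood W Y R C a ≤ blockLikelihood W Y R C b) :
    ∑ Y : Obs m n A, (∏ i, ∏ j, obsProb W ε (X i j) (Y i j)) * (if E Y then 1 else 0) ≤
      bhattacharyya W ε a b ^ (R.card * C.card) := by
  have hnn : ∀ Y : Obs m n A, 0 ≤ ∏ i, ∏ j, obsProb W ε (X i j) (Y i j) := fun Y =>
    Finset.prod_nonneg fun i _ => Finset.prod_nonneg fun j _ => obsProb_nonneg W hε0 hε1 _ _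
  calc _ ≤ ∑ Y : Obs m n A, (∏ i, ∏ j, obsProb W ε (X i j) (Y i j)) *
        ∏ i ∈ R, ∏ j ∈ C, sqrtRatio W a b (Y i j) := by
        refine Finset.sum_le_sum fun Y _ => ?_
        have hr : 0 ≤ ∏ i ∈ R, ∏ j ∈ C, sqrtRatio W a b (Y i j) :=
          Finset.prod_nonneg fun i _ => Finset.prod_nonneg fun j _ => Real.sqrt_nonneg _
        split_ifs with h
        -- Observations of probability zero contribute nothing. Otherwise the likelihood of `a` is
        -- positive, and the square root of the likelihood ratio is at least 1 on the event.
        · rcases (hnn Y).eq_or_lt with h0 | h0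
          · simp [← h0]
          refine mul_le_mul_of_nonneg_left ?_ (hnn Y)
          have hpos : ∀ i ∈ R, ∀ j ∈ C, 0 < (Y i j).elim 1 (fun y => W.prob a y) := by
            intro i hi j hj
            have h1 := Finset.prod_ne_zero_iff.1
              (Finset.prod_ne_zero_iff.1 h0.ne' i (Finset.mem_univ i)) j (Finset.mem_univ j)
            rw [hX i hi j hj] at h1
            cases hY : Y i j with
            | none => exact one_pos
            | some y =>
              rw [hY] at h1
              exact (W.nonneg a y).lt_of_ne' (right_ne_zero_of_mul h1)
          have hLa : 0 < blockLikelihood W Y R C a :=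
            Finset.prod_pos fun i hi => Finset.prod_pos fun j hj => hpos i hi j hj
          have hq : ∀ o : Option A, 0 ≤ o.elim 1 (fun y => W.prob b y) /
              o.elim 1 (fun y => W.prob a y) := by
            intro o
            cases o with
            | none => simp
            | some y => exact div_nonneg (W.nonneg b y) (W.nonneg a y)
          have : ∏ i ∈ R, ∏ j ∈ C, sqrtRatio W a b (Y i j) =
              √(blockLikelihood W Y R C b / blockLikelihood W Y R C a) := by
            unfold blockLikelihood sqrtRatio
            rw [← Finset.prod_div_distrib, Real.sqrt_prod R]
            · refine Finset.prod_congr rfl fun i _ => ?_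
              rw [← Finset.prod_div_distrib, Real.sqrt_prod C fun j _ => hq _]
            · intro i _
              rw [← Finset.prod_div_distrib]
              exact Finset.prod_nonneg fun j _ => hq _
          rw [this, Real.one_le_sqrt, one_le_div hLa]
          exact hE Y h
        · rw [mul_zero]
          exact mul_nonneg (hnn Y) hr
    _ = ∑ Y : Obs m n A, ∏ i, ∏ j, (obsProb W ε (X i j) (Y i j) *
        if i ∈ R ∧ j ∈ C then sqrtRatio W a b (Y i j) else 1) := by
        refine Finset.sum_congr rfl fun Y _ => ?_
        simp_rw [Finset.prod_mul_distrib]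
        congr 1
        rw [← Finset.prod_subset (Finset.subset_univ R)]
        · refine Finset.prod_congr rfl fun i hi => ?_
          rw [← Finset.prod_subset (Finset.subset_univ C)]
          · exact Finset.prod_congr rfl fun j hj => by simp [hi, hj]
          · intro j _ hj
            simp [hj]
        · intro i _ hi
          simp [hi]
    _ = ∏ i, ∏ j, if i ∈ R ∧ j ∈ C then bhattacharyya W ε a b else 1 := by
        rw [sum_matrix_prod fun i j o => obsProb W ε (X i j) o *
          if i ∈ R ∧ j ∈ C then sqrtRatio W a b o else 1]
        refine Finset.prod_congr rfl fun i _ => Finset.prod_congr rfl fun j _ => ?_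
        split_ifs with h
        · rw [hX i h.1 j h.2, sum_obsProb_mul_sqrtRatio]
        · simp only [mul_one, sum_obsProb]
    _ = _ := by
        rw [← Finset.prod_subset (Finset.subset_univ R)]
        · rw [mul_comm, pow_mul, ← Finset.prod_const]
          refine Finset.prod_congr rfl fun i hi => ?_
          rw [← Finset.prod_subset (Finset.subset_univ C), ← Finset.prod_const]
          · exact Finset.prod_congr rfl fun j hj => by simp [hi, hj]
          · intro j _ hj
            simp [hj]
        · intro i _ hi
          simp [hi]

/-- The event that maximum likelihood decoding in the true blocks may fail. -/
def LikelihoodError (W : DMC A) (P : Clustering m) (Q : Clustering n)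
    (u : P.parts → Q.parts → A) (Y : Obs m n A) : Prop :=
  ∃ (R : P.parts) (C : Q.parts) (b : A), b ≠ u R C ∧
    blockLikelihood W Y R C (u R C) ≤ blockLikelihood W Y R C b

/-- Union bound over at most `m * n` blocks and all letters, with the block values fixed. Ties count
as errors, which covers every tie-breaking. -/
theorem eventProb_likelihoodError_le [DecidableEq A] (hA : 2 ≤ Fintype.card A) (W : DMC A)
    {ε : ℝ} (hε0 : 0 ≤ ε) (hε1 : ε < 1) (P : Clustering m) (Q : Clustering n) {δ : ℝ}
    (hδ : ∀ R ∈ P.parts, ∀ C ∈ Q.parts, ∀ a b : A, a ≠ b →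
      bhattacharyya W ε a b ^ (R.card * C.card) ≤ δ) (hδ0 : 0 ≤ δ) :
    eventProb W ε P Q (LikelihoodError W P Q) ≤ (m * n * Fintype.card A) * δ := by
  classical
  calc _ ≤ ∑ x : (P.parts × Q.parts) × A, eventProb W ε P Q (fun u Y => x.2 ≠ u x.1.1 x.1.2 ∧
        blockLikelihood W Y x.1.1 x.1.2 (u x.1.1 x.1.2) ≤
          blockLikelihood W Y x.1.1 x.1.2 x.2) :=
        eventProb_le_sum_eventProb W hε0 hε1 P Q _ _ _
          fun u Y ⟨R, C, b, h⟩ => ⟨((R, C), b), Finset.mem_univ _, h⟩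
    _ ≤ ∑ _x : (P.parts × Q.parts) × A, δ := by
        refine Finset.sum_le_sum fun ⟨⟨R, C⟩, b⟩ _ => ?_
        unfold eventProb
        calc _ ≤ ∑ u : P.parts → Q.parts → A,
              (1 / (Fintype.card A : ℝ)) ^ (P.parts.card * Q.parts.card) * δ := by
              refine Finset.sum_le_sum fun u _ => ?_
              simp only [jointProb, mul_assoc]
              rw [← Finset.mul_sum]
              refine mul_le_mul_of_nonneg_left ?_ (by positivity)
              by_cases hb : b = u R C
              · simpa [hb] using hδ0
              · refine (sum_obs_likelihood_le W hε0 hε1 (blockMatrix P Q u) R C (u R C) b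
                  ?_ _ fun Y h => h.2).trans (hδ R R.2 C C.2 _ _ (Ne.symm hb))
                intro i hi j hj
                rw [blockMatrix_apply, (cluster_eq_iff P i R).2 hi, (cluster_eq_iff Q j C).2 hj]
          _ = δ := by rw [← Finset.sum_mul, sum_prior hA, one_mul]
    _ = (P.parts.card * Q.parts.card * Fintype.card A) * δ := by simp
    _ ≤ _ := by
        have h1 : (P.parts.card : ℝ) ≤ m := by exact_mod_cast card_clusters_le P
        have h2 : (Q.parts.card : ℝ) ≤ n := by exact_mod_cast card_clusters_le Q
        gcongr

variable [DecidableEq A]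

/-- If the clustering and the decoding in the true blocks are correct, so is the estimate. -/
theorem eq_blockMatrix_of_not_error {W : DMC A} {d₀ : ℝ} {φ : Obs m n A → Ratings m n A}
    (hφ : IsThresholdML W d₀ φ) {P : Clustering m} {Q : Clustering n}
    {u : P.parts → Q.parts → A} {Y : Obs m n A} (h1 : ¬ RowError P d₀ Y)
    (h2 : ¬ RowError Q d₀ (fun l k => Y k l)) (h3 : ¬ LikelihoodError W P Q u Y) :
    φ Y = blockMatrix P Q u := by
  unfold RowError at h1 h2
  push Not at h1 h2
  funext i j
  have hR : estRows d₀ Y i = P.part i := by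
    ext i'
    simp only [estRows, Finset.mem_filter, Finset.mem_univ, true_and, h1 i i']
    rw [← P.part_eq_iff_mem (P.part_mem.2 (Finset.mem_univ i)), eq_comm]
  have hC : estCols d₀ Y j = Q.part j := by
    ext j'
    rw [estCols, Finset.mem_filter, colDist, h2 j j', and_iff_right (Finset.mem_univ j'),
      ← Q.part_eq_iff_mem (Q.part_mem.2 (Finset.mem_univ j)), eq_comm]
  by_contra hne
  have := hφ Y i j (u (cluster P i) (cluster Q j))
  rw [hR, hC] at this
  exact h3 ⟨cluster P i, cluster Q j, φ Y i j, hne, this⟩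

theorem errorProb_le_of_isThresholdML (W : DMC A) {ε : ℝ} (hε0 : 0 ≤ ε) (hε1 : ε < 1) {d₀ : ℝ}
    (P : Clustering m) (Q : Clustering n) {φ : Obs m n A → Ratings m n A}
    (hφ : IsThresholdML W d₀ φ) :
    errorProb W ε P Q φ ≤ eventProb W ε P Q (fun _ Y => RowError P d₀ Y) +
      eventProb W ε Q P (fun _ Y => RowError Q d₀ Y) +
      eventProb W ε P Q (LikelihoodError W P Q) := by
  classical
  -- The column event is the row event of the transposed observation, whose law is the model with
  -- the two clusterings exchanged.
  rw [← eventProb_transpose W ε P Q (fun Y => RowError Q d₀ Y)]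
  simp only [errorProb, eventProb, ← Finset.sum_add_distrib, ← mul_add]
  refine Finset.sum_le_sum fun u _ => Finset.sum_le_sum fun Y _ =>
    mul_le_mul_of_nonneg_left ?_ (jointProb_nonneg W hε0 hε1 _ _ _ _)
  by_cases h1 : RowError P d₀ Y
  · split_ifs <;> norm_num
  by_cases h2 : RowError Q d₀ (fun l k => Y k l)
  · split_ifs <;> norm_num
  by_cases h3 : LikelihoodError W P Q u Y
  · split_ifs <;> norm_num
  rw [if_pos (eq_blockMatrix_of_not_error hφ h1 h2 h3)]
  split_ifs
  norm_num

theorem errorProb_nonneg (W : DMC A) {ε : ℝ} (hε0 : 0 ≤ ε) (hε1 : ε < 1)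
    (P : Clustering m) (Q : Clustering n) (φ : Obs m n A → Ratings m n A) :
    0 ≤ errorProb W ε P Q φ :=
  Finset.sum_nonneg fun _ _ => Finset.sum_nonneg fun _ _ =>
    mul_nonneg (jointProb_nonneg W hε0 hε1 _ _ _ _) (by split_ifs <;> norm_num)

end MaximumLikelihood

/-! ### Converse: independent failures of the blocks. -/

section Converse

/-- A sum over functions whose summand factors over the fibers of `f`. -/
theorem sum_prod_fiber {ι κ Ω : Type*} [Fintype ι] [DecidableEq ι] [Fintype κ] [DecidableEq κ]
    [Fintype Ω] (f : ι → κ) (G : ∀ k, ({i // f i = k} → Ω) → ℝ) :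
    ∑ Y : ι → Ω, ∏ k, G k (fun i => Y i) = ∏ k, ∑ y, G k y := by
  rw [Fintype.prod_sum]
  refine Fintype.sum_equiv ((Equiv.arrowCongr (Equiv.sigmaFiberEquiv f).symm (Equiv.refl Ω)).trans
    (Equiv.piCurry fun _ _ => Ω)) _ _ fun Y => rfl

variable {A Ω : Type*} [Fintype A] [DecidableEq A] [Fintype Ω] [DecidableEq Ω]

/-- The probability of a correct decision on a letter observed repeatedly through a channel for
which two letters can produce the same output `o`. -/
theorem sum_decision_le (hA : 2 ≤ Fintype.card A) {ι : Type*} [Fintype ι] [DecidableEq ι]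
    (p : A → Ω → ℝ) (hp : ∀ a o, 0 ≤ p a o) (hp1 : ∀ a, ∑ o, p a o = 1) {a b : A} (hab : a ≠ b)
    (o : Ω) {q : ℝ} (hq : 0 ≤ q) (ha : q ≤ p a o) (hb : q ≤ p b o) (g : (ι → Ω) → A) :
    ∑ y : ι → Ω, 1 / (Fintype.card A : ℝ) * ∏ i, p (g y) (y i) ≤
      1 - q ^ Fintype.card ι / Fintype.card A := by
  have hc : (0 : ℝ) < Fintype.card A := by positivity
  have hnn : ∀ (c : A) (y : ι → Ω), 0 ≤ ∏ i, p c (y i) :=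
    fun c y => Finset.prod_nonneg fun i _ => hp c _
  -- Deciding for `g y` loses the probabilities of `y` under all other letters. At the constant
  -- sequence `o`, at least one of `a` and `b` is among these.
  have hpt : ∀ y : ι → Ω, ∏ i, p (g y) (y i) ≤
      ∑ c, ∏ i, p c (y i) - if y = (fun _ => o) then q ^ Fintype.card ι else 0 := by
    intro y
    rw [← Finset.add_sum_erase _ _ (Finset.mem_univ (g y))]
    split_ifs with h
    · have : q ^ Fintype.card ι ≤ ∑ c ∈ Finset.univ.erase (g y), ∏ i, p c (y i) := by
        have hex : ∃ c ≠ g y, q ≤ p c o := by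
          by_cases hga : a = g y
          · exact ⟨b, fun h => hab (hga.trans h.symm), hb⟩
          · exact ⟨a, hga, ha⟩
        obtain ⟨c, hcne, hcq⟩ := hex
        refine le_trans ?_ (Finset.single_le_sum (fun c _ => hnn c y)
          (Finset.mem_erase.2 ⟨hcne, Finset.mem_univ c⟩))
        simp only [h, Finset.prod_const, Finset.card_univ]
        exact pow_le_pow_left₀ hq hcq _
      linarith
    · have := Finset.sum_nonneg fun c (_ : c ∈ Finset.univ.erase (g y)) => hnn c y
      linarith
  calc _ ≤ ∑ y : ι → Ω, 1 / (Fintype.card A : ℝ) * (∑ c, ∏ i, p c (y i) -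
        if y = (fun _ => o) then q ^ Fintype.card ι else 0) :=
        Finset.sum_le_sum fun y _ => mul_le_mul_of_nonneg_left (hpt y) (by positivity)
    _ = 1 / (Fintype.card A : ℝ) * (∑ c : A, ∏ _i : ι, ∑ o, p c o - q ^ Fintype.card ι) := by
        rw [← Finset.mul_sum, Finset.sum_sub_distrib, Finset.sum_comm]
        simp only [Finset.sum_ite_eq', Finset.mem_univ, if_true]
        congr 2
        exact Finset.sum_congr rfl fun c _ => (Fintype.prod_sum fun _ o => p c o).symm
    _ = _ := by
        simp only [hp1, Finset.prod_const_one, Finset.sum_const, Finset.card_univ, nsmul_eq_mul]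
        field_simp

/-- The probability that all of several independent letters are decided correctly. -/
theorem sum_all_correct_le (hA : 2 ≤ Fintype.card A) {ι κ : Type*} [Fintype ι] [DecidableEq ι]
    [Fintype κ] [DecidableEq κ] (f : ι → κ)
    (p : A → Ω → ℝ) (hp : ∀ a o, 0 ≤ p a o) (hp1 : ∀ a, ∑ o, p a o = 1) {a b : A} (hab : a ≠ b)
    (o : Ω) {q : ℝ} (hq : 0 ≤ q) (ha : q ≤ p a o) (hb : q ≤ p b o) (φ : (ι → Ω) → κ → A) :
    ∑ u : κ → A, ∑ Y : ι → Ω, (1 / (Fintype.card A : ℝ)) ^ Fintype.card κ *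
        (∏ i, p (u (f i)) (Y i)) * (if φ Y = u then 1 else 0) ≤
      ∏ k, (1 - q ^ Fintype.card {i // f i = k} / Fintype.card A) := by
  have hmax : ∀ k, ∃ g : ({i // f i = k} → Ω) → A, ∀ y c, ∏ i, p c (y i) ≤ ∏ i, p (g y) (y i) := by
    intro k
    have : Nonempty A := ⟨a⟩
    choose g hg using fun y : {i // f i = k} → Ω => Finite.exists_max fun c => ∏ i, p c (y i)
    exact ⟨g, hg⟩
  choose g hg using hmax
  calc _ = ∑ Y : ι → Ω, (1 / (Fintype.card A : ℝ)) ^ Fintype.card κ *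
        ∏ i, p (φ Y (f i)) (Y i) := by
        rw [Finset.sum_comm]
        exact Finset.sum_congr rfl fun Y _ => by simp
    _ = ∑ Y : ι → Ω, ∏ k, (1 / (Fintype.card A : ℝ) *
        ∏ i : {i // f i = k}, p (φ Y k) (Y i)) := by
        refine Finset.sum_congr rfl fun Y _ => ?_
        rw [Finset.prod_mul_distrib, Finset.prod_const, Finset.card_univ,
          ← Fintype.prod_fiberwise f]
        congr 1
        refine Finset.prod_congr rfl fun k _ => Finset.prod_congr rfl fun i _ => ?_
        rw [i.2]
    -- The estimate of block `k` may depend on all of `Y`. A maximizer of the block likelihood does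
    -- no worse and depends on that block alone, so the sum factors.
    _ ≤ ∑ Y : ι → Ω, ∏ k, (1 / (Fintype.card A : ℝ) *
        ∏ i : {i // f i = k}, p (g k fun i => Y i) (Y i)) := by
        refine Finset.sum_le_sum fun Y _ => Finset.prod_le_prod (fun k _ =>
          mul_nonneg (by positivity) (Finset.prod_nonneg fun i _ => hp _ _)) fun k _ =>
          mul_le_mul_of_nonneg_left (hg k (fun i => Y i) _) (by positivity)
    _ = ∏ k, ∑ y : {i // f i = k} → Ω, 1 / (Fintype.card A : ℝ) * ∏ i, p (g k y) (y i) :=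
        sum_prod_fiber f fun k y => 1 / (Fintype.card A : ℝ) * ∏ i, p (g k y) (y i)
    _ ≤ _ := Finset.prod_le_prod (fun k _ => Finset.sum_nonneg fun y _ =>
        mul_nonneg (by positivity) (Finset.prod_nonneg fun i _ => hp _ _)) fun k _ =>
        sum_decision_le hA p hp hp1 hab o hq ha hb (g k)

variable {m n : ℕ}

theorem card_block (P : Clustering m) (Q : Clustering n) (x : P.parts × Q.parts) :
    Fintype.card {i : Fin m × Fin n // (cluster P i.1, cluster Q i.2) = x} =
      (x.1 : Finset (Fin m)).card * (x.2 : Finset (Fin n)).card := by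
  rw [Fintype.card_subtype, ← Finset.card_product]
  congr 1
  ext i
  simp [Prod.ext_iff, cluster_eq_iff]

/-- The probability that an estimator recovers the rating matrix. -/
theorem one_sub_errorProb_le (hA : 2 ≤ Fintype.card A) (W : DMC A) {ε : ℝ} (hε0 : 0 ≤ ε)
    (hε1 : ε < 1) {a b : A} (hab : a ≠ b) (o : Option A) {q : ℝ} (hq : 0 ≤ q)
    (ha : q ≤ obsProb W ε a o) (hb : q ≤ obsProb W ε b o) (P : Clustering m) (Q : Clustering n)
    (φ : Obs m n A → Ratings m n A) :
    1 - errorProb W ε P Q φ ≤ ∏ x : P.parts × Q.parts,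
      (1 - q ^ ((x.1 : Finset (Fin m)).card * (x.2 : Finset (Fin n)).card) / Fintype.card A) := by
  have : Nonempty A := ⟨a⟩
  -- The block values of the estimate. If the estimate is not block constant they are arbitrary,
  -- which is harmless in an upper bound on the success probability.
  set ψ : (Fin m × Fin n → Option A) → P.parts × Q.parts → A := fun Y =>
    Function.uncurry (Function.invFun (blockMatrix P Q) (φ (Function.curry Y))) with hψ
  have h := sum_all_correct_le hA (fun i : Fin m × Fin n => (cluster P i.1, cluster Q i.2))
    (obsProb W ε) (obsProb_nonneg W hε0 hε1) (sum_obsProb W ε) hab o hq ha hb ψ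
  simp only [card_block] at h
  refine le_trans ?_ h
  have h1 : 1 - errorProb W ε P Q φ = ∑ u, ∑ Y, jointProb W ε P Q u Y - errorProb W ε P Q φ := by
    rw [sum_jointProb hA]
  rw [h1, errorProb, ← Finset.sum_sub_distrib, ← (Equiv.curry P.parts Q.parts A).sum_comp]
  refine Finset.sum_le_sum fun u _ => ?_
  rw [← Finset.sum_sub_distrib, ← (Equiv.curry (Fin m) (Fin n) (Option A)).sum_comp]
  refine Finset.sum_le_sum fun Y _ => ?_
  have hj : jointProb W ε P Q (Function.curry u) (Function.curry Y) =
      (1 / (Fintype.card A : ℝ)) ^ Fintype.card (P.parts × Q.parts) *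
        ∏ i : Fin m × Fin n, obsProb W ε (u (cluster P i.1, cluster Q i.2)) (Y i) := by
    rw [jointProb, Fintype.card_prod, Fintype.card_coe, Fintype.card_coe, Fintype.prod_prod_type]
    rfl
  rw [Equiv.curry_apply, Equiv.curry_apply, ← hj, ← mul_one_sub]
  refine mul_le_mul_of_nonneg_left ?_ (jointProb_nonneg W hε0 hε1 _ _ _ _)
  by_cases hφ : φ (Function.curry Y) = blockMatrix P Q (Function.curry u)
  · have : ψ Y = u := by
      rw [hψ]
      simp only [hφ]
      rw [Function.leftInverse_invFun (blockMatrix_injective P Q)]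
      rfl
    simp [this, hφ]
  · simp only [hφ, if_false, sub_self]
    split_ifs <;> norm_num

theorem errorProb_le_one (hA : 2 ≤ Fintype.card A) (W : DMC A) {ε : ℝ} (hε0 : 0 ≤ ε)
    (hε1 : ε < 1) (P : Clustering m) (Q : Clustering n) (φ : Obs m n A → Ratings m n A) :
    errorProb W ε P Q φ ≤ 1 := by
  rw [← sum_jointProb hA W ε P Q]
  exact Finset.sum_le_sum fun u _ => Finset.sum_le_sum fun Y _ =>
    mul_le_of_le_one_right (jointProb_nonneg W hε0 hε1 _ _ _ _) (by split_ifs <;> norm_num)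

/-- A quantitative converse. -/
theorem one_sub_errorProb_le_log_div (hA : 2 ≤ Fintype.card A) (W : DMC A) {ε : ℝ}
    (hε0 : 0 ≤ ε) (hε1 : ε < 1) {a b : A} (hab : a ≠ b) (o : Option A) {q : ℝ} (hq : 0 < q)
    (hq1 : q < 1) (ha : q ≤ obsProb W ε a o) (hb : q ≤ obsProb W ε b o) (P : Clustering m)
    (Q : Clustering n) (φ : Obs m n A → Ratings m n A) {η : ℝ} (hη : 0 < η) (hmn : 0 < m * n)
    (h : ∀ R ∈ P.parts, ∀ C ∈ Q.parts, (R.card : ℝ) * (C.card : ℝ) <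
      (1 - η) * (Real.log ((m : ℝ) * n) / Real.log (1 / q))) :
    1 - errorProb W ε P Q φ ≤ Fintype.card A / Real.log (1 / q) *
      (Real.log ((m : ℝ) * n) / ((m : ℝ) * n) ^ η) := by
  have hN1 : (1 : ℝ) ≤ (m : ℝ) * n := by exact_mod_cast hmn
  obtain ⟨N, hN⟩ : ∃ N : ℝ, N = (m : ℝ) * n := ⟨_, rfl⟩
  rw [← hN] at h hN1 ⊢
  have hN0 : 0 < N := by linarith
  have hc : (0 : ℝ) < Fintype.card A := by positivity
  have hlq : 0 < Real.log (1 / q) := Real.log_pos (by rwa [lt_div_iff₀ hq, one_mul])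
  obtain ⟨L, hL⟩ : ∃ L : ℝ, L = (1 - η) * (Real.log N / Real.log (1 / q)) := ⟨_, rfl⟩
  rw [← hL] at h
  set s : P.parts × Q.parts → ℕ := fun x =>
    (x.1 : Finset (Fin m)).card * (x.2 : Finset (Fin n)).card with hs
  have hsL : ∀ x, (s x : ℝ) < L := fun x => by
    rw [hs]
    push_cast
    exact h _ x.1.2 _ x.2.2
  have hsum : ∑ x, (s x : ℝ) = N := by
    rw [hN, ← sum_card_clusters P, ← sum_card_clusters Q, Finset.sum_mul_sum,
      Fintype.sum_prod_type]
    push_cast [hs]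
    rfl
  -- The areas sum to N > 0, so some area is positive, and it lies below `L`. This excludes η ≥ 1.
  have hL0 : 0 < L := by
    have : ∃ x, 0 < (s x : ℝ) := by
      by_contra hcon
      push Not at hcon
      have := Finset.sum_nonpos fun x (_ : x ∈ Finset.univ) => hcon x
      linarith
    obtain ⟨x, hx⟩ := this
    exact hx.trans (hsL x)
  -- By the choice of `L`, q^L = N^(η-1). The weight `s x / L ≤ 1` lets the exponents be added
  -- through ∑ s = N, without counting blocks.
  have hqs : ∀ x, N ^ η / N * (s x / L) ≤ q ^ s x := by
    intro x
    have h1 : N ^ η / N = q ^ L := by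
      rw [← Real.rpow_sub_one hN0.ne', Real.rpow_def_of_pos hN0, Real.rpow_def_of_pos hq, hL,
        one_div, Real.log_inv]
      have : Real.log q ≠ 0 := by
        rw [one_div, Real.log_inv] at hlq
        linarith
      congr 1
      field_simp
      ring
    have h2 : q ^ L ≤ q ^ s x := by
      rw [← Real.rpow_natCast]
      exact Real.rpow_le_rpow_of_exponent_ge hq hq1.le (hsL x).le
    rw [h1]
    exact (mul_le_of_le_one_right (Real.rpow_nonneg hq.le _)
      ((div_le_one hL0).2 (hsL x).le)).trans h2
  have ht : 0 < N ^ η / (L * Fintype.card A) := by positivity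
  calc _ ≤ ∏ x, (1 - q ^ s x / Fintype.card A) :=
        one_sub_errorProb_le hA W hε0 hε1 hab o hq.le ha hb P Q φ
    _ ≤ ∏ x, Real.exp (-(N ^ η / N * (s x / L) / Fintype.card A)) := by
        refine Finset.prod_le_prod (fun x _ => ?_) fun x _ => ?_
        · rw [sub_nonneg, div_le_one hc]
          have : (2 : ℝ) ≤ Fintype.card A := by exact_mod_cast hA
          linarith [pow_le_one₀ (n := s x) hq.le hq1.le]
        · refine le_trans ?_ (Real.exp_le_exp.2 (neg_le_neg
            (div_le_div_of_nonneg_right (hqs x) hc.le)))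
          linarith [Real.add_one_le_exp (-(q ^ s x / (Fintype.card A : ℝ)))]
    _ = Real.exp (-(N ^ η / (L * Fintype.card A))) := by
        rw [← Real.exp_sum, Finset.sum_neg_distrib, ← Finset.sum_div, ← Finset.mul_sum,
          ← Finset.sum_div, hsum]
        congr 2
        field_simp
    _ ≤ (N ^ η / (L * Fintype.card A))⁻¹ := by
        rw [Real.exp_neg]
        exact inv_anti₀ ht (by linarith [Real.add_one_le_exp (N ^ η / (L * Fintype.card A))])
    _ = Fintype.card A * (L / N ^ η) := by field_simp
    _ ≤ Fintype.card A * (Real.log N / Real.log (1 / q) / N ^ η) := by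
        have : L ≤ Real.log N / Real.log (1 / q) := by
          rw [hL]
          exact mul_le_of_le_one_left (div_nonneg (Real.log_nonneg hN1) hlq.le) (by linarith)
        gcongr
    _ = _ := by ring

open Filter Topology in
theorem tendsto_errorProb_one (hA : 2 ≤ Fintype.card A) (W : DMC A) {ε : ℝ}
    (hε0 : 0 ≤ ε) (hε1 : ε < 1) {a b : A} (hab : a ≠ b) (o : Option A) {q : ℝ} (hq : 0 < q)
    (hq1 : q < 1) (ha : q ≤ obsProb W ε a o) (hb : q ≤ obsProb W ε b o) {η : ℝ} (hη : 0 < η)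
    (m n : ℕ → ℕ) (P : ∀ k, Clustering (m k)) (Q : ∀ k, Clustering (n k))
    (hmn : Tendsto (fun k => m k * n k) atTop atTop)
    (h : ∀ᶠ k in atTop, ∀ R ∈ (P k).parts, ∀ C ∈ (Q k).parts, (R.card : ℝ) * (C.card : ℝ) <
      (1 - η) * (Real.log ((m k : ℝ) * (n k : ℝ)) / Real.log (1 / q)))
    (φ : ∀ k, Obs (m k) (n k) A → Ratings (m k) (n k) A) :
    Tendsto (fun k => errorProb W ε (P k) (Q k) (φ k)) atTop (𝓝 1) := by
  have hN : Tendsto (fun k => (m k : ℝ) * (n k : ℝ)) atTop atTop := by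
    simpa [Function.comp_def] using tendsto_natCast_atTop_atTop (R := ℝ).comp hmn
  have h0 : Tendsto (fun k => Fintype.card A / Real.log (1 / q) *
      (Real.log ((m k : ℝ) * n k) / ((m k : ℝ) * n k) ^ η)) atTop (𝓝 0) := by
    have := ((isLittleO_log_rpow_atTop hη).tendsto_div_nhds_zero.comp hN).const_mul
      (Fintype.card A / Real.log (1 / q))
    simpa using this
  have h1 := h0.const_sub 1
  rw [sub_zero] at h1
  refine tendsto_of_tendsto_of_tendsto_of_le_of_le' h1 tendsto_const_nhds ?_
    (Eventually.of_forall fun k => errorProb_le_one hA W hε0 hε1 _ _ _)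
  filter_upwards [h, hmn.eventually_gt_atTop 0] with k hk hk0
  have := one_sub_errorProb_le_log_div hA W hε0 hε1 hab o hq hq1 ha hb (P k) (Q k) (φ k) hη hk0 hk
  linarith

end Converse

/-! ### Achievability: the error bound and its limit. -/

section Achievability

variable {A : Type*} [Fintype A] [DecidableEq A]

open Filter Topology

/-- If m ≤ B and n ≤ M m, then mn ≤ |M| B². Both sizes must grow because the error bound contains
1/m and 1/n. -/
theorem tendsto_atTop_of_ratio_bounded {m n : ℕ → ℕ}
    (hmn : Tendsto (fun k => m k * n k) atTop atTop)
    (h : IsBoundedUnder (· ≤ ·) atTop (fun k => (n k : ℝ) / (m k : ℝ))) :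
    Tendsto m atTop atTop := by
  obtain ⟨M, hM⟩ := h
  rw [eventually_map] at hM
  rw [tendsto_atTop]
  intro B
  obtain ⟨N, hN⟩ := exists_nat_gt (|M| * (B : ℝ) ^ 2)
  filter_upwards [hM, hmn.eventually_ge_atTop N, hmn.eventually_gt_atTop 0] with k h1 h2 h3
  by_contra hlt
  push Not at hlt
  have hm : 0 < (m k : ℝ) := by exact_mod_cast Nat.pos_of_mul_pos_right h3
  rw [div_le_iff₀ hm] at h1
  have h2' : (N : ℝ) ≤ (m k : ℝ) * n k := by exact_mod_cast h2
  have hlt' : (m k : ℝ) ≤ B := by exact_mod_cast hlt.le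
  have : (m k : ℝ) * n k ≤ |M| * (B : ℝ) ^ 2 := by
    calc (m k : ℝ) * n k ≤ m k * (|M| * m k) :=
          mul_le_mul_of_nonneg_left (h1.trans
            (mul_le_mul_of_nonneg_right (le_abs_self M) hm.le)) hm.le
      _ = |M| * (m k : ℝ) ^ 2 := by ring
      _ ≤ _ := by gcongr
  linarith

/-- A quantitative achievability bound. -/
theorem errorProb_le_of_large_blocks (hA : 2 ≤ Fintype.card A) (W : DMC A) {ε : ℝ} (hε0 : 0 ≤ ε)
    (hε1 : ε < 1) {d₀ : ℝ} (h0 : dLower W < d₀) (h1 : d₀ < dUpper W) {p : ℝ} (hp0 : 0 < p)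
    (hp1 : p < 1) (hβ : ∀ a b : A, a ≠ b → bhattacharyya W ε a b ≤ p ^ 2) {c : ℝ} (hc : 0 < c)
    (hcl : c ≤ (1 - ε) ^ 2 * (d₀ - dLower W)) (hcu : c ≤ (1 - ε) ^ 2 * (dUpper W - d₀))
    {m n : ℕ} (hm : 0 < m) (hn : 0 < n) (P : Clustering m) (Q : Clustering n)
    (hQ : 48 / c ^ 2 * Real.log m ≤ (n : ℝ) ^ 2 / ∑ C ∈ Q.parts, (C.card : ℝ) ^ 2)
    (hP : 48 / c ^ 2 * Real.log n ≤ (m : ℝ) ^ 2 / ∑ R ∈ P.parts, (R.card : ℝ) ^ 2)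
    (hs : ∀ R ∈ P.parts, ∀ C ∈ Q.parts, Real.log ((m : ℝ) * n) / Real.log (1 / p) <
      (R.card : ℝ) * (C.card : ℝ)) {φ : Obs m n A → Ratings m n A}
    (hφ : IsThresholdML W d₀ φ) :
    errorProb W ε P Q φ ≤ 1 / m + 1 / n + Fintype.card A * (1 / m * (1 / n)) := by
  have hN : 0 < (m : ℝ) * n := by positivity
  have hlp : 0 < Real.log (1 / p) := Real.log_pos (by rwa [lt_div_iff₀ hp0, one_mul])
  -- The hypothesis on the areas gives p^s ≤ 1/(mn) only, which a union bound over mn blocks would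
  -- use up; the square in `hβ` supplies the missing factor.
  have hblock : ∀ R ∈ P.parts, ∀ C ∈ Q.parts, ∀ a b : A, a ≠ b →
      bhattacharyya W ε a b ^ (R.card * C.card) ≤ (((m : ℝ) * n)⁻¹) ^ 2 := by
    intro R hR C hC a b hab
    calc _ ≤ (p ^ 2) ^ (R.card * C.card) :=
          pow_le_pow_left₀ (bhattacharyya_nonneg W hε0 hε1 a b) (hβ a b hab) _
      _ = (p ^ (R.card * C.card)) ^ 2 := by rw [← pow_mul, ← pow_mul, mul_comm]
      _ ≤ _ := by
          refine pow_le_pow_left₀ (by positivity) ?_ 2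
          have := (div_lt_iff₀ hlp).1 (hs R hR C hC)
          rw [← Real.log_le_log_iff (by positivity) (by positivity), Real.log_pow, Real.log_inv]
          rw [one_div, Real.log_inv] at this
          push_cast
          linarith
  refine (errorProb_le_of_isThresholdML W hε0 hε1 P Q hφ).trans ?_
  refine add_le_add (add_le_add (eventProb_rowError_le hA W hε0 hε1 h0 h1 P Q hc hcl hcu hQ)
    (eventProb_rowError_le hA W hε0 hε1 h0 h1 Q P hc hcl hcu hP)) ?_
  refine (eventProb_likelihoodError_le hA W hε0 hε1 P Q hblock (by positivity)).trans (le_of_eq ?_)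
  field_simp

theorem tendsto_errorProb_zero (hA : 2 ≤ Fintype.card A) (W : DMC A) {ε : ℝ} (hε0 : 0 ≤ ε)
    (hε1 : ε < 1) {d₀ : ℝ} (h0 : dLower W < d₀) (h1 : d₀ < dUpper W) {p : ℝ} (hp0 : 0 < p)
    (hp1 : p < 1) (hβ : ∀ a b : A, a ≠ b → bhattacharyya W ε a b ≤ p ^ 2) :
    ∃ K : ℝ, 0 < K ∧ ∀ (m n : ℕ → ℕ) (P : ∀ k, Clustering (m k)) (Q : ∀ k, Clustering (n k)),
      Tendsto (fun k => m k * n k) atTop atTop →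
      (∀ᶠ k in atTop, K * Real.log (m k) ≤
        (n k : ℝ) ^ 2 / ∑ C ∈ (Q k).parts, (C.card : ℝ) ^ 2) →
      (∀ᶠ k in atTop, K * Real.log (n k) ≤
        (m k : ℝ) ^ 2 / ∑ R ∈ (P k).parts, (R.card : ℝ) ^ 2) →
      IsBoundedUnder (· ≤ ·) atTop (fun k => (m k : ℝ) / (n k : ℝ)) →
      IsBoundedUnder (· ≤ ·) atTop (fun k => (n k : ℝ) / (m k : ℝ)) →
      (∀ᶠ k in atTop, ∀ R ∈ (P k).parts, ∀ C ∈ (Q k).parts,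
        Real.log ((m k : ℝ) * (n k : ℝ)) / Real.log (1 / p) < (R.card : ℝ) * (C.card : ℝ)) →
      ∀ φ : ∀ k, Obs (m k) (n k) A → Ratings (m k) (n k) A,
        (∀ k, IsThresholdML W d₀ (φ k)) →
        Tendsto (fun k => errorProb W ε (P k) (Q k) (φ k)) atTop (𝓝 0) := by
  have he : 0 < (1 - ε) ^ 2 := by
    have : 0 < 1 - ε := by linarith
    positivity
  -- `c` is the smaller distance of the two mean scores per column from zero.
  obtain ⟨c, hc⟩ : ∃ c, c = min ((1 - ε) ^ 2 * (d₀ - dLower W)) ((1 - ε) ^ 2 * (dUpper W - d₀)) :=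
    ⟨_, rfl⟩
  have hc0 : 0 < c := by
    rw [hc]
    exact lt_min (mul_pos he (by linarith)) (mul_pos he (by linarith))
  refine ⟨48 / c ^ 2, by positivity, ?_⟩
  intro m n P Q hmn hQ hP hr1 hr2 hs φ hφ
  have hm := tendsto_atTop_of_ratio_bounded hmn hr2
  have hn := tendsto_atTop_of_ratio_bounded (m := n) (n := m)
    (by simpa only [mul_comm] using hmn) hr1
  have hm' : Tendsto (fun k => 1 / (m k : ℝ)) atTop (𝓝 0) :=
    tendsto_one_div_atTop_nhds_zero_nat.comp hm
  have hn' : Tendsto (fun k => 1 / (n k : ℝ)) atTop (𝓝 0) :=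
    tendsto_one_div_atTop_nhds_zero_nat.comp hn
  have hlim := (hm'.add hn').add ((hm'.mul hn').const_mul (Fintype.card A : ℝ))
  simp only [add_zero, mul_zero] at hlim
  refine tendsto_of_tendsto_of_tendsto_of_le_of_le' tendsto_const_nhds hlim
    (Eventually.of_forall fun k => errorProb_nonneg W hε0 hε1 _ _ _) ?_
  filter_upwards [hQ, hP, hs, hm.eventually_gt_atTop 0, hn.eventually_gt_atTop 0]
    with k hQk hPk hsk hmk hnk
  exact errorProb_le_of_large_blocks hA W hε0 hε1 h0 h1 hp0 hp1 hβ hc0 (hc ▸ min_le_left _ _)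
    (hc ▸ min_le_right _ _) hmk hnk (P k) (Q k) hQk hPk hsk (hφ k)

end Achievability

/-! ### A polynomial time program for the estimator. -/

section PolynomialTime

/-- Every program runs in a number of steps that is polynomial in the sizes of the input. -/
theorem Prog.exists_steps_le (p : Prog) : ∃ c d : ℕ, ∀ (I : Input) (ρ : ℕ → ℕ),
    p.steps I ρ ≤ c * (I.rows + I.cols + I.letters + 1) ^ d := by
  have hadd : ∀ (N c₁ c₂ d₁ d₂ x y : ℕ), 1 ≤ N → x ≤ c₁ * N ^ d₁ → y ≤ c₂ * N ^ d₂ →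
      x + y + 1 ≤ (c₁ + c₂ + 1) * N ^ (d₁ + d₂) := by
    intro N c₁ c₂ d₁ d₂ x y hN hx hy
    have h1 : N ^ d₁ ≤ N ^ (d₁ + d₂) := Nat.pow_le_pow_right hN (by omega)
    have h2 : N ^ d₂ ≤ N ^ (d₁ + d₂) := Nat.pow_le_pow_right hN (by omega)
    have h3 : 1 ≤ N ^ (d₁ + d₂) := Nat.one_le_pow _ _ hN
    nlinarith [Nat.mul_le_mul_left c₁ h1, Nat.mul_le_mul_left c₂ h2]
  have hloop : ∀ (I : Input) (D : Range) (c d : ℕ) (f : ℕ → ℕ),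
      (∀ k, f k ≤ c * (I.rows + I.cols + I.letters + 1) ^ d) →
      1 + ∑ k ∈ Finset.range (D.size I), (f k + 2) ≤
        (c + 3) * (I.rows + I.cols + I.letters + 1) ^ (d + 1) := by
    intro I D c d f hf
    obtain ⟨N, hN⟩ : ∃ N, N = I.rows + I.cols + I.letters + 1 := ⟨_, rfl⟩
    rw [← hN] at hf ⊢
    have hD : D.size I ≤ N := by cases D <;> simp only [Range.size] <;> omega
    have h1 : 1 ≤ N ^ d := Nat.one_le_pow _ _ (by omega)
    have h2 : ∑ k ∈ Finset.range (D.size I), (f k + 2) ≤ N * ((c + 2) * N ^ d) := by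
      refine (Finset.sum_le_card_nsmul _ _ ((c + 2) * N ^ d) fun k _ => ?_).trans ?_
      · nlinarith [hf k]
      · rw [Finset.card_range, smul_eq_mul]
        exact Nat.mul_le_mul_right _ hD
    have h3 : 1 ≤ N ^ (d + 1) := Nat.one_le_pow _ _ (by omega)
    calc _ ≤ N ^ (d + 1) + N * ((c + 2) * N ^ d) := add_le_add h3 h2
      _ = _ := by ring
  induction p with
  | const _ | var _ | obs _ _ | chan _ _ | thr => exact ⟨1, 0, fun I ρ => by simp [Prog.steps]⟩
  | add s t hs ht | sub s t hs ht | mul s t hs ht | div s t hs ht =>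
    obtain ⟨c₁, d₁, h₁⟩ := hs
    obtain ⟨c₂, d₂, h₂⟩ := ht
    exact ⟨_, _, fun I ρ => hadd _ c₁ c₂ d₁ d₂ _ _ (by omega) (h₁ I ρ) (h₂ I ρ)⟩
  | ifLt s t a b hs ht ha hb =>
    obtain ⟨c₁, d₁, h₁⟩ := hs
    obtain ⟨c₂, d₂, h₂⟩ := ht
    obtain ⟨c₃, d₃, h₃⟩ := ha
    obtain ⟨c₄, d₄, h₄⟩ := hb
    -- Both branches are charged, so that the bound does not depend on the test.
    refine ⟨_, _, fun I ρ => le_trans ?_ (hadd _ _ _ _ _ _ _ (by omega)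
      (hadd _ c₁ c₂ d₁ d₂ _ _ (by omega) (h₁ I ρ) (h₂ I ρ))
      (hadd _ c₃ c₄ d₃ d₄ _ _ (by omega) (h₃ I ρ) (h₄ I ρ)))⟩
    simp only [Prog.steps]
    split_ifs <;> omega
  | sum v D body hb | prod v D body hb =>
    obtain ⟨c, d, h⟩ := hb
    exact ⟨_, _, fun I ρ => hloop I D c d _ fun k => h I _⟩

theorem Prog.exists_totalSteps_le (p : Prog) (l : ℕ) : ∃ c d : ℕ, ∀ I : Input, I.letters = l →
    p.totalSteps I ≤ c * (I.rows + I.cols) ^ d := by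
  obtain ⟨c, d, h⟩ := p.exists_steps_le
  refine ⟨c * (l + 2) ^ d + 2, d + 2, fun I hI => ?_⟩
  obtain ⟨M, hM⟩ : ∃ M, M = I.rows + I.cols := ⟨_, rfl⟩
  have hs : ∀ ρ, p.steps I ρ + 2 ≤ c * (M + l + 1) ^ d + 2 := fun ρ => by
    have := h I ρ
    rw [hI, ← hM] at this
    omega
  have ht : p.totalSteps I ≤ M * (M * (c * (M + l + 1) ^ d + 2)) := by
    unfold Prog.totalSteps
    refine (Finset.sum_le_card_nsmul _ _ (M * (c * (M + l + 1) ^ d + 2)) fun i _ => ?_).trans ?_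
    · refine (Finset.sum_le_card_nsmul _ _ _ fun j _ => hs _).trans ?_
      rw [Finset.card_range, smul_eq_mul]
      exact Nat.mul_le_mul_right _ (by omega)
    · rw [Finset.card_range, smul_eq_mul]
      exact Nat.mul_le_mul_right _ (by omega)
  rw [← hM]
  -- The target bound vanishes at `M = 0`, where no entry is computed. For `M ≥ 1` the number of
  -- letters is absorbed into the constant.
  rcases Nat.eq_zero_or_pos M with h0 | h0
  · simpa [h0] using ht
  refine ht.trans ?_
  have h1 : M + l + 1 ≤ (l + 2) * M := by nlinarith
  have h2 : (M + l + 1) ^ d ≤ (l + 2) ^ d * M ^ d := by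
    rw [← mul_pow]
    exact Nat.pow_le_pow_left h1 d
  have h3 : 1 ≤ M ^ d := Nat.one_le_pow _ _ h0
  calc _ ≤ M * (M * (c * ((l + 2) ^ d * M ^ d) + 2 * M ^ d)) := by gcongr; omega
    _ = _ := by ring

/-- The program for the normalized distance of the rows `x` and `y`. -/
def rowDistProg (x y k : ℕ) : Prog :=
  .div
    (.sum k .cols (.ifLt (.const 0) (.obs x k) (.ifLt (.const 0) (.obs y k)
      -- Inequality of two symbols is tested by two strict comparisons.
      (.ifLt (.obs x k) (.obs y k) (.const 1)
        (.ifLt (.obs y k) (.obs x k) (.const 1) (.const 0))) (.const 0)) (.const 0)))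
    (.sum k .cols (.ifLt (.const 0) (.obs x k) (.ifLt (.const 0) (.obs y k)
      (.const 1) (.const 0)) (.const 0)))

/-- The program for the normalized distance of the columns `x` and `y`. -/
def colDistProg (x y k : ℕ) : Prog :=
  .div
    (.sum k .rows (.ifLt (.const 0) (.obs k x) (.ifLt (.const 0) (.obs k y)
      (.ifLt (.obs k x) (.obs k y) (.const 1)
        (.ifLt (.obs k y) (.obs k x) (.const 1) (.const 0))) (.const 0)) (.const 0)))
    (.sum k .rows (.ifLt (.const 0) (.obs k x) (.ifLt (.const 0) (.obs k y)
      (.const 1) (.const 0)) (.const 0)))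

/-- The program for the likelihood of the letter `a` in the estimated block of the entry given by
the counters `0` and `1`. -/
def likelihoodProg (a : ℕ) : Prog :=
  .prod 2 .rows (.ifLt (rowDistProg 0 2 4) .thr
    (.prod 3 .cols (.ifLt (colDistProg 1 3 4) .thr
      -- Tables are addressed by counters only, so the loop searches for the letter whose stored
      -- number plus one is the symbol. All other letters contribute 1, and so does every letter at
      -- an erasure.
      (.prod 4 .letters (.ifLt (.obs 2 3) (.add (.var 4) (.const 1)) (.const 1)
        (.ifLt (.add (.var 4) (.const 1)) (.obs 2 3) (.const 1) (.chan a 4))))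
      (.const 1)))
    (.const 1))

/-- The program for the smallest maximizer of the likelihood. -/
def estimateProg : Prog :=
  -- Counts the letters `t` such that no letter `s ≤ t` is a maximizer; this count is the index of
  -- the smallest maximizer.
  .sum 7 .letters (.prod 5 .letters (.ifLt (.var 7) (.var 5) (.const 1)
    (.sub (.const 1) (.prod 6 .letters
      (.ifLt (likelihoodProg 5) (likelihoodProg 6) (.const 0) (.const 1))))))

variable {A : Type*} [Fintype A] {m n : ℕ}

theorem encodeInput_obs (e : A ≃ Fin (Fintype.card A)) (W : DMC A) (d₀ : ℝ) (Y : Obs m n A)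
    (i : Fin m) (j : Fin n) :
    (encodeInput e W d₀ Y).obs i j = (Y i j).elim 0 (fun y => (e y : ℕ) + 1) := by
  simp [encodeInput]

theorem encodeInput_chan (e : A ≃ Fin (Fintype.card A)) (W : DMC A) (d₀ : ℝ) (Y : Obs m n A)
    (a y : A) : (encodeInput e W d₀ Y).chan (e a) (e y) = W.prob a y := by
  simp [encodeInput]

theorem encode_lt_iff (e : A ≃ Fin (Fintype.card A)) (o : Option A) :
    0 < o.elim 0 (fun y => (e y : ℕ) + 1) ↔ o ≠ none := by
  cases o <;> simp

theorem encode_injective (e : A ≃ Fin (Fintype.card A)) :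
    Function.Injective fun o : Option A => o.elim 0 (fun y => (e y : ℕ) + 1) := by
  intro o o' h
  cases o <;> cases o' <;> simp_all [Fin.val_inj]

open Classical in
/-- The tests made on a pair of stored observations. -/
theorem pair_test_eq (e : A ≃ Fin (Fintype.card A)) (o o' : Option A) (x y : ℕ)
    (hx : x = o.elim 0 (fun y => (e y : ℕ) + 1)) (hy : y = o'.elim 0 (fun y => (e y : ℕ) + 1)) :
    (if (0 : ℝ) < (x : ℝ) then if (0 : ℝ) < (y : ℝ) then
      if (x : ℝ) < y then (1 : ℝ) else if (y : ℝ) < x then (1 : ℝ) else (0 : ℝ)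
      else (0 : ℝ) else (0 : ℝ)) =
      if o ≠ none ∧ o' ≠ none ∧ o ≠ o' then 1 else 0 := by
  have h1 := encode_lt_iff e o
  have h2 := encode_lt_iff e o'
  have h3 : x = y ↔ o = o' := by rw [hx, hy]; exact (encode_injective e).eq_iff
  rw [← hx] at h1
  rw [← hy] at h2
  simp only [Nat.cast_lt, Nat.cast_pos, h1, h2, ne_eq, ← h3]
  rcases lt_trichotomy x y with h | h | h
  · simp [h, h.ne, ite_and]
  · simp [h]
  · simp [h, h.ne', not_lt_of_gt h, ite_and]

open Classical in
theorem pair_count_eq (e : A ≃ Fin (Fintype.card A)) (o o' : Option A) (x y : ℕ)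
    (hx : x = o.elim 0 (fun y => (e y : ℕ) + 1)) (hy : y = o'.elim 0 (fun y => (e y : ℕ) + 1)) :
    (if (0 : ℝ) < (x : ℝ) then if (0 : ℝ) < (y : ℝ) then (1 : ℝ)
      else (0 : ℝ) else (0 : ℝ)) = if o ≠ none ∧ o' ≠ none then 1 else 0 := by
  have h1 := encode_lt_iff e o
  have h2 := encode_lt_iff e o'
  rw [← hx] at h1
  rw [← hy] at h2
  simp only [Nat.cast_pos, h1, h2, ite_and]

variable [DecidableEq A]

theorem value_rowDistProg (e : A ≃ Fin (Fintype.card A)) (W : DMC A) (d₀ : ℝ) (Y : Obs m n A)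
    {x y k : ℕ} (hx : x ≠ k) (hy : y ≠ k) (ρ : ℕ → ℕ) (i i' : Fin m) (hi : ρ x = i)
    (hi' : ρ y = i') : (rowDistProg x y k).value (encodeInput e W d₀ Y) ρ = rowDist Y i i' := by
  simp only [rowDistProg, Prog.value, Range.size, Function.update_self,
    Function.update_of_ne hx, Function.update_of_ne hy, hi, hi', Nat.cast_zero, Nat.cast_one]
  rw [rowDist, Finset.card_filter, Finset.card_filter]
  push_cast
  congr 1
  · refine (Finset.sum_range _).trans (Finset.sum_congr rfl fun k _ => ?_)
    convert pair_test_eq e (Y i k) (Y i' k) _ _ (encodeInput_obs e W d₀ Y i k)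
      (encodeInput_obs e W d₀ Y i' k) using 2
  · refine (Finset.sum_range _).trans (Finset.sum_congr rfl fun k _ => ?_)
    convert pair_count_eq e (Y i k) (Y i' k) _ _ (encodeInput_obs e W d₀ Y i k)
      (encodeInput_obs e W d₀ Y i' k) using 2

theorem value_colDistProg (e : A ≃ Fin (Fintype.card A)) (W : DMC A) (d₀ : ℝ) (Y : Obs m n A)
    {x y k : ℕ} (hx : x ≠ k) (hy : y ≠ k) (ρ : ℕ → ℕ) (j j' : Fin n) (hj : ρ x = j)
    (hj' : ρ y = j') : (colDistProg x y k).value (encodeInput e W d₀ Y) ρ = colDist Y j j' := by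
  simp only [colDistProg, Prog.value, Range.size, Function.update_self,
    Function.update_of_ne hx, Function.update_of_ne hy, hj, hj', Nat.cast_zero, Nat.cast_one]
  rw [colDist, rowDist, Finset.card_filter, Finset.card_filter]
  push_cast
  congr 1
  · refine (Finset.sum_range _).trans (Finset.sum_congr rfl fun k _ => ?_)
    convert pair_test_eq e (Y k j) (Y k j') _ _ (encodeInput_obs e W d₀ Y k j)
      (encodeInput_obs e W d₀ Y k j') using 2
  · refine (Finset.sum_range _).trans (Finset.sum_congr rfl fun k _ => ?_)
    convert pair_count_eq e (Y k j) (Y k j') _ _ (encodeInput_obs e W d₀ Y k j)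
      (encodeInput_obs e W d₀ Y k j') using 2

omit [DecidableEq A] in
open Classical in
/-- The contribution of one observation to the likelihood, as a product over the letters. -/
theorem prod_letters_eq (e : A ≃ Fin (Fintype.card A)) (W : DMC A) (d₀ : ℝ) (Y : Obs m n A)
    (i : Fin m) (j : Fin n) (a : A) :
    (∏ k ∈ Finset.range (Fintype.card A),
      if (((encodeInput e W d₀ Y).obs i j : ℕ) : ℝ) < (k : ℝ) + (1 : ℝ) then (1 : ℝ)
      else if (k : ℝ) + (1 : ℝ) < (((encodeInput e W d₀ Y).obs i j : ℕ) : ℝ)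
        then (1 : ℝ) else (encodeInput e W d₀ Y).chan (e a) k) =
      (Y i j).elim 1 (fun y => W.prob a y) := by
  have h1 : ∀ x y : ℕ, (x : ℝ) < (y : ℝ) + 1 ↔ x < y + 1 := fun x y => by norm_cast
  have h2 : ∀ x y : ℕ, (y : ℝ) + 1 < (x : ℝ) ↔ y + 1 < x := fun x y => by norm_cast
  rw [Finset.prod_range, ← e.prod_comp]
  simp only [encodeInput_chan, encodeInput_obs, h1, h2]
  cases Y i j with
  | none => simp
  | some y =>
    simp only [Option.elim]
    rw [Finset.prod_eq_single y]
    · simp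
    · intro z _ hz
      have : (e z : ℕ) ≠ e y := fun h => hz (e.injective (Fin.ext h))
      rcases Nat.lt_or_gt_of_ne this with h | h
      · simp [h]
      · simp [h]
    · simp

/-- The loops overwrite the counters 2, 3 and 4, so the letter is kept in a counter above 4. -/
theorem value_likelihoodProg (e : A ≃ Fin (Fintype.card A)) (W : DMC A) (d₀ : ℝ)
    (Y : Obs m n A) {v : ℕ} (hv : 4 < v) (ρ : ℕ → ℕ) (i : Fin m) (j : Fin n) (a : A)
    (h0 : ρ 0 = i) (h1 : ρ 1 = j) (ha : ρ v = e a) :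
    (likelihoodProg v).value (encodeInput e W d₀ Y) ρ =
      blockLikelihood W Y (estRows d₀ Y i) (estCols d₀ Y j) a := by
  have h2v : v ≠ 2 := by omega
  have h3v : v ≠ 3 := by omega
  have h4v : v ≠ 4 := by omega
  unfold likelihoodProg
  rw [Prog.value, blockLikelihood, estRows, Finset.prod_filter]
  refine (Finset.prod_range _).trans (Finset.prod_congr rfl fun i' _ => ?_)
  rw [Prog.value, value_rowDistProg e W d₀ Y (by norm_num) (by norm_num) _ i i' (by simp [h0])
    (by simp)]
  simp only [Prog.value, Nat.cast_one]
  congr 1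
  rw [estCols, Finset.prod_filter]
  refine (Finset.prod_range _).trans (Finset.prod_congr rfl fun j' _ => ?_)
  rw [value_colDistProg e W d₀ Y (by norm_num) (by norm_num) _ j j' (by simp [h1]) (by simp)]
  congr 1
  rw [← prod_letters_eq e W d₀ Y i' j' a]
  refine Finset.prod_congr rfl fun k _ => ?_
  simp [h2v, h3v, h4v, ha, Function.update_of_ne]

omit [DecidableEq A] in
/-- The smallest maximizer of a function on the alphabet, in the given enumeration. -/
theorem exists_smallest_maximizer [Nonempty A] (e : A ≃ Fin (Fintype.card A)) (L : A → ℝ) :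
    ∃ a, (∀ b, L b ≤ L a) ∧ ∀ c, (∀ b, L b ≤ L c) → e a ≤ e c := by
  obtain ⟨a₀, h₀⟩ := Finite.exists_max L
  obtain ⟨a, ha, hmin⟩ := Set.exists_min_image {a | ∀ b, L b ≤ L a} e (Set.toFinite _) ⟨a₀, h₀⟩
  exact ⟨a, ha, hmin⟩

omit [DecidableEq A] in
open Classical in
/-- The index of the smallest maximizer counts the letters below all maximizers. -/
theorem sum_prod_eq_smallest_maximizer (e : A ≃ Fin (Fintype.card A)) (L : A → ℝ) (a : A)
    (ha : ∀ b, L b ≤ L a) (hmin : ∀ c, (∀ b, L b ≤ L c) → e a ≤ e c) :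
    ∑ t : A, ∏ s : A, (if ((e t : ℕ) : ℝ) < ((e s : ℕ) : ℝ) then (1 : ℝ) else
      (1 : ℝ) - ∏ b : A, if L s < L b then (0 : ℝ) else (1 : ℝ)) =
      ((e a : ℕ) : ℝ) := by
  have hterm : ∀ t : A, ∏ s : A, (if ((e t : ℕ) : ℝ) < ((e s : ℕ) : ℝ) then (1 : ℝ) else
      (1 : ℝ) - ∏ b : A, if L s < L b then (0 : ℝ) else (1 : ℝ)) =
      if e t < e a then 1 else 0 := by
    intro t
    -- Below `a` no letter up to `t` is a maximizer and every factor is 1; otherwise the factor at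
    -- `a` is 0.
    split_ifs with h
    · refine Finset.prod_eq_one fun s _ => ?_
      split_ifs with hts
      · simp
      · have hs : ¬ ∀ b, L b ≤ L s := fun hs => by
          have h1 := hmin s hs
          rw [Nat.cast_lt, Fin.val_fin_lt] at hts
          exact hts (h.trans_le h1)
        push Not at hs
        obtain ⟨b, hb⟩ := hs
        rw [Finset.prod_eq_zero (Finset.mem_univ b) (by simp [hb])]
        simp
    · refine Finset.prod_eq_zero (Finset.mem_univ a) ?_
      simp only [Nat.cast_lt, Fin.val_fin_lt, h, if_false]
      rw [Finset.prod_eq_one]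
      · simp
      · intro b _
        simp [not_lt.2 (ha b)]
  simp only [hterm]
  rw [e.sum_comp fun t => if t < e a then (1 : ℝ) else 0, ← Finset.sum_filter,
    Finset.sum_const, nsmul_one]
  congr 1
  rw [← Fin.card_Iio]
  congr 1
  ext t
  simp

theorem value_estimateProg (e : A ≃ Fin (Fintype.card A)) (W : DMC A) (d₀ : ℝ)
    (Y : Obs m n A) (i : Fin m) (j : Fin n) (a : A)
    (ha : ∀ b, blockLikelihood W Y (estRows d₀ Y i) (estCols d₀ Y j) b ≤
      blockLikelihood W Y (estRows d₀ Y i) (estCols d₀ Y j) a)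
    (hmin : ∀ c, (∀ b, blockLikelihood W Y (estRows d₀ Y i) (estCols d₀ Y j) b ≤
      blockLikelihood W Y (estRows d₀ Y i) (estCols d₀ Y j) c) → e a ≤ e c) :
    estimateProg.value (encodeInput e W d₀ Y) (entryCounters i j) = ((e a : ℕ) : ℝ) := by
  rw [← sum_prod_eq_smallest_maximizer e _ a ha hmin]
  simp only [estimateProg, Prog.value]
  refine (Finset.sum_range _).trans ?_
  refine (e.sum_comp _).symm.trans (Finset.sum_congr rfl fun t _ => ?_)
  refine (Finset.prod_range _).trans ?_
  refine (e.prod_comp _).symm.trans (Finset.prod_congr rfl fun s _ => ?_)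
  simp only [Nat.cast_zero, Nat.cast_one]
  congr 2
  refine (Finset.prod_range _).trans ?_
  refine (e.prod_comp _).symm.trans (Finset.prod_congr rfl fun b _ => ?_)
  rw [value_likelihoodProg e W d₀ Y (by norm_num) _ i j s (by simp [entryCounters])
    (by simp [entryCounters]) (by simp), value_likelihoodProg e W d₀ Y (by norm_num) _ i j b
    (by simp [entryCounters]) (by simp [entryCounters]) (by simp)]

/-- With a suitable tie-breaking, the threshold estimator is computable in polynomial time. -/
theorem exists_isPolyTime [Nonempty A] (e : A ≃ Fin (Fintype.card A)) (W : DMC A) (d₀ : ℝ) :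
    ∃ φ : ∀ m n : ℕ, Obs m n A → Ratings m n A,
      (∀ m n, IsThresholdML W d₀ (φ m n)) ∧ IsPolyTime e W d₀ φ := by
  choose φ hφ hmin using fun (m n : ℕ) (Y : Obs m n A) (i : Fin m) (j : Fin n) =>
    exists_smallest_maximizer e (blockLikelihood W Y (estRows d₀ Y i) (estCols d₀ Y j))
  obtain ⟨c, d, h⟩ := estimateProg.exists_totalSteps_le (Fintype.card A)
  exact ⟨φ, fun m n Y i j => hφ m n Y i j, estimateProg, c, d, fun m n Y =>
    ⟨fun i j => value_estimateProg e W d₀ Y i j _ (hφ m n Y i j) (hmin m n Y i j),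
      h (encodeInput e W d₀ Y) rfl⟩⟩

end PolynomialTime

/-! ### Choice of the two constants. -/

section Constants

variable {A : Type*} [Fintype A]

/-- The common observation is an erasure if ε > 0 and a shared output otherwise. The cap 1/2 keeps
the constant below 1; without a common observation any value would do. -/
theorem exists_converse_constant (hA : 2 ≤ Fintype.card A) (W : DMC A) {ε : ℝ} (hε1 : ε < 1) :
    ∃ p : ℝ, 0 < p ∧ p < 1 ∧ ((0 < ε ∨ ∃ a b y : A, a ≠ b ∧ 0 < W.prob a y ∧ 0 < W.prob b y) →
      ∃ (a b : A) (o : Option A), a ≠ b ∧ p ≤ obsProb W ε a o ∧ p ≤ obsProb W ε b o) := by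
  by_cases H : 0 < ε ∨ ∃ a b y : A, a ≠ b ∧ 0 < W.prob a y ∧ 0 < W.prob b y
  · have : ∃ (a b : A) (o : Option A), a ≠ b ∧ 0 < obsProb W ε a o ∧ 0 < obsProb W ε b o := by
      rcases H with h | ⟨a, b, y, hab, ha, hb⟩
      · obtain ⟨a, b, hab⟩ := Fintype.one_lt_card_iff.1 hA
        exact ⟨a, b, none, hab, h, h⟩
      · exact ⟨a, b, some y, hab, mul_pos (by linarith) ha, mul_pos (by linarith) hb⟩
    obtain ⟨a, b, o, hab, ha, hb⟩ := this
    exact ⟨min (1 / 2) (min (obsProb W ε a o) (obsProb W ε b o)),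
      lt_min (by norm_num) (lt_min ha hb), (min_le_left _ _).trans_lt (by norm_num),
      fun _ => ⟨a, b, o, hab, (min_le_right _ _).trans (min_le_left _ _),
        (min_le_right _ _).trans (min_le_right _ _)⟩⟩
  · exact ⟨1 / 2, by norm_num, by norm_num, fun h => absurd h H⟩

-- Finitely many coefficients are below 1, so every p close enough to 1 has p² above all of them and
-- exceeds any given q < 1.
open Filter Topology in
theorem exists_achievability_constant (W : DMC A) {ε : ℝ} (hε1 : ε < 1) {q : ℝ} (hq : q < 1) :
    ∃ p : ℝ, q < p ∧ p < 1 ∧ ((∀ a b : A, a ≠ b → ∃ y, W.prob a y ≠ W.prob b y) →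
      ∀ a b : A, a ≠ b → bhattacharyya W ε a b ≤ p ^ 2) := by
  by_cases H : ∀ a b : A, a ≠ b → ∃ y, W.prob a y ≠ W.prob b y
  · have hsq : Tendsto (fun p : ℝ => p ^ 2) (𝓝[<] 1) (𝓝 1) := by
      have := ((continuous_pow 2).tendsto (1 : ℝ)).mono_left (nhdsWithin_le_nhds (s := Set.Iio 1))
      simpa using this
    have h1 : ∀ᶠ p in 𝓝[<] (1 : ℝ), ∀ a b : A, a ≠ b → bhattacharyya W ε a b ≤ p ^ 2 := by
      rw [eventually_all]
      intro a
      rw [eventually_all]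
      intro b
      by_cases hab : a = b
      · simp [hab]
      · filter_upwards [hsq.eventually_const_lt (bhattacharyya_lt_one W hε1 (H a b hab))]
          with p hp _
        exact hp.le
    obtain ⟨p, hp, hqp⟩ := (h1.and (Ioo_mem_nhdsLT hq)).exists
    exact ⟨p, hqp.1, hqp.2, fun _ => hp⟩
  · exact ⟨(q + 1) / 2, by linarith, by linarith, fun h => absurd h H⟩

end Constants

end CollabFilter

theorem mainTheorem2 {A : Type*} [Fintype A] [DecidableEq A] (hA : 2 ≤ Fintype.card A)
    (W : CollabFilter.DMC A) (ε : ℝ) (hε0 : 0 ≤ ε) (hε1 : ε < 1) :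
    ∃ p₁ p₂ : ℝ, p₁ ∈ Set.Ioo (0 : ℝ) 1 ∧ p₂ ∈ Set.Ioo (0 : ℝ) 1 ∧ p₂ < p₁ ∧
      -- converse
      ((0 < ε ∨ ∃ a b y : A, a ≠ b ∧ 0 < W.prob a y ∧ 0 < W.prob b y) →
        ∀ (η : ℝ), 0 < η →
        ∀ (m n : ℕ → ℕ) (P : ∀ k, CollabFilter.Clustering (m k))
          (Q : ∀ k, CollabFilter.Clustering (n k)),
        Filter.Tendsto (fun k => m k * n k) Filter.atTop Filter.atTop →
        (∀ᶠ k in Filter.atTop, ∀ R ∈ (P k).parts, ∀ C ∈ (Q k).parts,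
          (R.card : ℝ) * (C.card : ℝ) <
            (1 - η) * (Real.log ((m k : ℝ) * (n k : ℝ)) / Real.log (1 / p₂))) →
        ∀ φ : ∀ k, CollabFilter.Obs (m k) (n k) A → CollabFilter.Ratings (m k) (n k) A,
          Filter.Tendsto (fun k => CollabFilter.errorProb W ε (P k) (Q k) (φ k))
            Filter.atTop (nhds 1)) ∧
      -- achievability
      ((∀ a b : A, a ≠ b → ∃ y, W.prob a y ≠ W.prob b y) →
        ∀ d₀ ∈ Set.Ioo (CollabFilter.dLower W) (CollabFilter.dUpper W),
        (∀ e : A ≃ Fin (Fintype.card A),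
          ∃ φ : ∀ m n : ℕ, CollabFilter.Obs m n A → CollabFilter.Ratings m n A,
            (∀ m n, CollabFilter.IsThresholdML W d₀ (φ m n)) ∧
              CollabFilter.IsPolyTime e W d₀ φ) ∧
        ∃ K : ℝ, 0 < K ∧
          ∀ (m n : ℕ → ℕ) (P : ∀ k, CollabFilter.Clustering (m k))
            (Q : ∀ k, CollabFilter.Clustering (n k)),
          Filter.Tendsto (fun k => m k * n k) Filter.atTop Filter.atTop →
          (∀ᶠ k in Filter.atTop, K * Real.log (m k) ≤
            (n k : ℝ) ^ 2 / ∑ C ∈ (Q k).parts, (C.card : ℝ) ^ 2) →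
          (∀ᶠ k in Filter.atTop, K * Real.log (n k) ≤
            (m k : ℝ) ^ 2 / ∑ R ∈ (P k).parts, (R.card : ℝ) ^ 2) →
          Filter.IsBoundedUnder (· ≤ ·) Filter.atTop (fun k => (m k : ℝ) / (n k : ℝ)) →
          Filter.IsBoundedUnder (· ≤ ·) Filter.atTop (fun k => (n k : ℝ) / (m k : ℝ)) →
          (∀ᶠ k in Filter.atTop, ∀ R ∈ (P k).parts, ∀ C ∈ (Q k).parts,
            Real.log ((m k : ℝ) * (n k : ℝ)) / Real.log (1 / p₁) <
              (R.card : ℝ) * (C.card : ℝ)) →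
          ∀ φ : ∀ k, CollabFilter.Obs (m k) (n k) A → CollabFilter.Ratings (m k) (n k) A,
            (∀ k, CollabFilter.IsThresholdML W d₀ (φ k)) →
            Filter.Tendsto (fun k => CollabFilter.errorProb W ε (P k) (Q k) (φ k))
              Filter.atTop (nhds 0)) := by
  obtain ⟨p₂, hp₂0, hp₂1, hconv⟩ := CollabFilter.exists_converse_constant hA W hε1
  -- Increasing p₁ only strengthens the hypothesis on the block areas, so p₁ may be taken above p₂.
  obtain ⟨p₁, hp₂₁, hp₁1, hach⟩ := CollabFilter.exists_achievability_constant W hε1 hp₂1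
  have hp₁0 : 0 < p₁ := hp₂0.trans hp₂₁
  refine ⟨p₁, p₂, ⟨hp₁0, hp₁1⟩, ⟨hp₂0, hp₂1⟩, hp₂₁, ?_, ?_⟩
  · intro H η hη m n P Q hmn h φ
    obtain ⟨a, b, o, hab, ha, hb⟩ := hconv H
    exact CollabFilter.tendsto_errorProb_one hA W hε0 hε1 hab o hp₂0 hp₂1 ha hb hη m n P Q hmn h φ
  · intro H d₀ hd
    have : Nonempty A := Fintype.card_pos_iff.1 (by omega)
    exact ⟨fun e => CollabFilter.exists_isPolyTime e W d₀,
      CollabFilter.tendsto_errorProb_zero hA W hε0 hε1 hd.1 hd.2 hp₁0 hp₁1 (hach H)⟩
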